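/- Let $d\ge 1$, let $\Omega\subset\mathbb R^d$ be a bounded open convex set, let $\tau>0$, and let $\mu\in L^1(\Omega)$ with $\mu\ge 0$. For functions $\phi,\psi$ on $\Omega$ put $$\phi^c(x)=\inf_{y\in\Omega}\phi(y)+\tfrac1{2\tau}|x-y|^2,\qquad \psi^{\bar c}(y)=\sup_{x\in\Omega}\psi(x)-\tfrac1{2\tau}|x-y|^2,\qquad F(\phi)=\int_\Omega\phi^c(x)\,\mu(x)\,dx ,$$ and call $\phi\in C(\Omega)$ $c$-convex if $\phi^{c\bar c}=\phi$ on $\Omega$. Let $\phi\in C^2(\Omega)$ be $c$-convex, and assume that (i) there is $\lambda>0$ such that all eigenvalues of $I_{d\times d}+\tau D^2\phi(y)$ are at least $\lambda$, for every $y\in\Omega$; (ii) for almost every $x\in\Omega$ with $\mu(x)>0$ the infimum defining $\phi^c(x)$ is attained at a point of $\Omega$ (that is, $T_\phi(x)=\operatorname{argmin}_{y\in\Omega}\phi(y)+\frac1{2\tau}|x-y|^2$ exists). Then for every Lipschitz function $h:\Omega\to\mathbb R$ the second variation $\delta^2F(\phi)(h,h)$ exists, in the sense that $\delta F(\phi+th)(h)=\frac{d}{dt}F(\phi+th)$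 exists for all $t$ near $0$ and is differentiable at $t=0$ with derivative $\delta^2F(\phi)(h,h)$, and $$\delta^2F(\phi)(h,h)=-\tau\int_\Omega\nabla h(y)\cdot\operatorname{cof}\bigl(I_{d\times d}+\tau D^2\phi(y)\bigr)\nabla h(y)\,\mu\bigl(y+\tau\nabla\phi(y)\bigr)\,dy ,$$ where the integrand is integrable and $\operatorname{cof}$ denotes the cofactor matrix. Furthermore, if $\mu\in L^\infty(\Omega)$ and if the eigenvalues of $I_{d\times d}+\tau D^2\phi(y)$ are bounded above by a constant $\Lambda$ for every $y\in\Omega$, then $$-\delta^2F(\phi)(h,h)\le\tau\,\|\mu\|_{L^\infty(\Omega)}\,\Lambda^{d-1}\,\|\nabla h\|_{L^2(\Omega)}^2 .$$ -/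

import Mathlib

open MeasureTheory Filter Topology

noncomputable section

/-- Backward `c`-transform for the cost `|x - y|² / (2τ)` on `Ω`:
`φ^c(x) = inf_{y ∈ Ω} φ(y) + |x - y|² / (2τ)`. -/
def backwardCTransform {d : ℕ} (Ω : Set (EuclideanSpace ℝ (Fin d))) (τ : ℝ)
    (φ : EuclideanSpace ℝ (Fin d) → ℝ) (x : EuclideanSpace ℝ (Fin d)) : ℝ :=
  ⨅ y : Ω, (φ y + ‖x - (y : EuclideanSpace ℝ (Fin d))‖ ^ 2 / (2 * τ))

/-- Forward `c`-transform: `ψ^{c̄}(y) = sup_{x ∈ Ω} ψ(x) - |x - y|² / (2τ)`. -/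
def forwardCTransform {d : ℕ} (Ω : Set (EuclideanSpace ℝ (Fin d))) (τ : ℝ)
    (ψ : EuclideanSpace ℝ (Fin d) → ℝ) (y : EuclideanSpace ℝ (Fin d)) : ℝ :=
  ⨆ x : Ω, (ψ x - ‖(x : EuclideanSpace ℝ (Fin d)) - y‖ ^ 2 / (2 * τ))

/-- `φ` is `c`-convex on `Ω`: it is continuous and `φ^{c c̄} = φ` on `Ω`.
For bounded `Ω` this forces `φ` to be bounded below on `Ω`, also with the convention that the
infimum of a set of reals that is unbounded below is `0`: then `φ^c` would vanish identically,
and so would `φ^{c c̄} = φ` on `Ω`. So the infimum and the supremum are genuine ones. -/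
def IsCConvex {d : ℕ} (Ω : Set (EuclideanSpace ℝ (Fin d))) (τ : ℝ)
    (φ : EuclideanSpace ℝ (Fin d) → ℝ) : Prop :=
  ContinuousOn φ Ω ∧
    ∀ y ∈ Ω, forwardCTransform Ω τ (backwardCTransform Ω τ φ) y = φ y

/-- `y` is a value of `T_φ(x)`, the minimizer over `Ω` of `y ↦ φ(y) + |x - y|² / (2τ)`. -/
def IsCMinimizer {d : ℕ} (Ω : Set (EuclideanSpace ℝ (Fin d))) (τ : ℝ)
    (φ : EuclideanSpace ℝ (Fin d) → ℝ) (x y : EuclideanSpace ℝ (Fin d)) : Prop :=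
  y ∈ Ω ∧ IsMinOn (fun z => φ z + ‖x - z‖ ^ 2 / (2 * τ)) Ω y

/-- The functional `F(φ) = ∫_Ω φ^c(x) μ(x) dx`. -/
def cTransformFunctional {d : ℕ} (Ω : Set (EuclideanSpace ℝ (Fin d))) (τ : ℝ)
    (μ : EuclideanSpace ℝ (Fin d) → ℝ) (φ : EuclideanSpace ℝ (Fin d) → ℝ) : ℝ :=
  ∫ x in Ω, backwardCTransform Ω τ φ x * μ x

/-- `δ²F(φ)(h,h)` exists and equals `v`: the first variation `δF(φ + t h)(h)` exists for all `t`
near `0`, and it is differentiable in `t` at `t = 0` with derivative `v`. -/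
def HasSecondVariation {X : Type*} (F : (X → ℝ) → ℝ) (φ h : X → ℝ) (v : ℝ) : Prop :=
  ∃ δF : ℝ → ℝ,
    (∀ᶠ t in 𝓝 (0 : ℝ), HasDerivAt (fun s : ℝ => F (φ + s • h)) (δF t) t) ∧
      HasDerivAt δF v 0

/-- The Hessian matrix `D²φ(y)`, with entries `∂ᵢ∂ⱼ φ(y)`. -/
def hessianMatrix {d : ℕ} (φ : EuclideanSpace ℝ (Fin d) → ℝ)
    (y : EuclideanSpace ℝ (Fin d)) : Matrix (Fin d) (Fin d) ℝ :=
  Matrix.of fun i j =>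
    fderiv ℝ (fderiv ℝ φ) y (EuclideanSpace.single i 1) (EuclideanSpace.single j 1)

/-- The cofactor matrix, the transpose of the adjugate. -/
def cofactorMatrix {d : ℕ} (M : Matrix (Fin d) (Fin d) ℝ) : Matrix (Fin d) (Fin d) ℝ :=
  M.adjugate.transpose

/-- The matrix `I + τ D²φ(y)`. -/
def mapJacobian {d : ℕ} (τ : ℝ) (φ : EuclideanSpace ℝ (Fin d) → ℝ)
    (y : EuclideanSpace ℝ (Fin d)) : Matrix (Fin d) (Fin d) ℝ :=
  1 + τ • hessianMatrix φ y

/-- The integrand `∇h(y) · cof(I + τ D²φ(y)) ∇h(y) μ(y + τ ∇φ(y))`. -/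
def hessianIntegrand {d : ℕ} (τ : ℝ) (μ φ h : EuclideanSpace ℝ (Fin d) → ℝ)
    (y : EuclideanSpace ℝ (Fin d)) : ℝ :=
  inner ℝ (gradient h y)
      (Matrix.toEuclideanLin (cofactorMatrix (mapJacobian τ φ y)) (gradient h y)) *
    μ (y + τ • gradient φ y)

end

/-! Put `Φ y = ‖y‖²/2 + τ φ y`. Expanding the cost gives `φ^c(x) = ‖x‖²/(2τ) + τ⁻¹ min_y (Φ y - ⟪x,
y⟫)`. By `c`-convexity `φ` is Lipschitz, as is `h`, so both extend to the whole space and the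
minimum may be taken over the compact closure of `Ω`, where a minimizer `T_t(x)` for `φ + t h`
exists for every `t`.

First variation: the minimal value is Lipschitz in `x`, and any minimizer is minus its gradient
wherever that exists. Rademacher's theorem makes minimizers unique for almost every `x`, and
Danskin's theorem with dominated convergence gives `δF(φ + t h)(h) = ∫ h(T_t x) μ(x) dx` for every
`t` (`hasDerivAt_integral_minValue`).

Second variation: (i) makes `Φ` strongly convex, with injective gradient map `S = id + τ∇φ` and `DS
= A = I + τD²φ`. By `c`-convexity `S` maps `Ω` into itself, and by (ii) `μ` vanishes almost
everywhere off `S(Ω)`. For `x = S y` the unperturbed minimizer is `y`, strong convexity gives `‖T_t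
x - y‖ ≤ C|t|`, and comparison with a quadratic model gives `T_t x = y - tτ A⁻¹∇h(y) + o(t)`
(`hasDerivAt_comp_minimizer`). The difference quotients of `h(T_t x)` are thus dominated and
converge to `-τ⟪∇h, A⁻¹∇h⟫`. The substitution `x = S y` brings in `det A`, and `det A · A⁻¹` is the
cofactor matrix (`hasDerivAt_integral_comp_argmin`).

For the bound, each eigenvalue of the cofactor matrix is a product of `d - 1` eigenvalues of `A`,
and `μ ∘ S ≤ ‖μ‖_∞` almost everywhere because preimages of null sets under `S` are null. -/

/-! ### Spectral bounds for symmetric matrices and their adjugates. -/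

theorem OrthonormalBasis.inner_map_eq_sum {ι E : Type*} [Fintype ι] [NormedAddCommGroup E]
    [InnerProductSpace ℝ E] (b : OrthonormalBasis ι ℝ E) (T : E →ₗ[ℝ] E) (c : ι → ℝ)
    (hT : ∀ i, T (b i) = c i • b i) (v : E) :
    inner ℝ v (T v) = ∑ i, c i * (inner ℝ (b i) v) ^ 2 := by
  have hTv : T v = ∑ i, (inner ℝ (b i) v * c i) • b i := by
    conv_lhs => rw [← b.sum_repr' v]
    simp [hT, smul_smul]
  rw [hTv, inner_sum]
  refine Finset.sum_congr rfl fun i _ => ?_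
  rw [inner_smul_right, real_inner_comm]
  ring

namespace Matrix

variable {d : ℕ} {M : Matrix (Fin d) (Fin d) ℝ}

theorem IsHermitian.toEuclideanLin_eigenvectorBasis (hM : M.IsHermitian) (i : Fin d) :
    toEuclideanLin M (hM.eigenvectorBasis i) = hM.eigenvalues i • hM.eigenvectorBasis i := by
  apply (WithLp.ofLp_injective 2)
  simpa using hM.mulVec_eigenvectorBasis i

theorem IsHermitian.hasEigenvalue_eigenvalues (hM : M.IsHermitian) (i : Fin d) :
    Module.End.HasEigenvalue (Matrix.toLin' M) (hM.eigenvalues i) := by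
  refine Module.End.hasEigenvalue_of_hasEigenvector (x := (hM.eigenvectorBasis i).ofLp) ⟨?_, ?_⟩
  · rw [Module.End.mem_eigenspace_iff, toLin'_apply, hM.mulVec_eigenvectorBasis]
  · intro h0
    have h1 : hM.eigenvectorBasis i = 0 := WithLp.ofLp_injective 2 (by simpa using h0)
    have h2 := hM.eigenvectorBasis.orthonormal.1 i
    rw [h1, norm_zero] at h2
    exact zero_ne_one h2

theorem IsHermitian.le_inner_toEuclideanLin (hM : M.IsHermitian) {lam : ℝ}
    (hlow : ∀ κ : ℝ, Module.End.HasEigenvalue (Matrix.toLin' M) κ → lam ≤ κ)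
    (v : EuclideanSpace ℝ (Fin d)) :
    lam * ‖v‖ ^ 2 ≤ inner ℝ v (toEuclideanLin M v) := by
  rw [hM.eigenvectorBasis.inner_map_eq_sum _ _ hM.toEuclideanLin_eigenvectorBasis,
    ← hM.eigenvectorBasis.sum_sq_norm_inner_right, Finset.mul_sum]
  refine Finset.sum_le_sum fun i _ => ?_
  rw [Real.norm_eq_abs, sq_abs]
  exact mul_le_mul_of_nonneg_right (hlow _ (hM.hasEigenvalue_eigenvalues i)) (sq_nonneg _)

theorem IsHermitian.det_pos_of_eigenvalue_ge (hM : M.IsHermitian) {lam : ℝ} (hlam : 0 < lam)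
    (hlow : ∀ κ : ℝ, Module.End.HasEigenvalue (Matrix.toLin' M) κ → lam ≤ κ) : 0 < M.det := by
  rw [hM.det_eq_prod_eigenvalues]
  exact Finset.prod_pos fun i _ => hlam.trans_le (hlow _ (hM.hasEigenvalue_eigenvalues i))

/-- Since `adj M * M = det M`, the adjugate is diagonal in the eigenbasis of `M`, each eigenvalue
being the product of the other eigenvalues of `M`. Positivity allows the cancellation. -/
theorem IsHermitian.inner_adjugate_le (hM : M.IsHermitian) {lam Λ : ℝ} (hlam : 0 < lam)
    (hlow : ∀ κ : ℝ, Module.End.HasEigenvalue (Matrix.toLin' M) κ → lam ≤ κ)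
    (hup : ∀ κ : ℝ, Module.End.HasEigenvalue (Matrix.toLin' M) κ → κ ≤ Λ)
    (v : EuclideanSpace ℝ (Fin d)) :
    inner ℝ v (toEuclideanLin M.adjugate v) ≤ Λ ^ (d - 1) * ‖v‖ ^ 2 := by
  have hpos : ∀ i, 0 < hM.eigenvalues i := fun i =>
    hlam.trans_le (hlow _ (hM.hasEigenvalue_eigenvalues i))
  have key : ∀ i, toEuclideanLin M.adjugate (hM.eigenvectorBasis i) =
      (∏ j ∈ Finset.univ.erase i, hM.eigenvalues j) • hM.eigenvectorBasis i := by
    intro i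
    have h1 : hM.eigenvalues i • toEuclideanLin M.adjugate (hM.eigenvectorBasis i) =
        M.det • hM.eigenvectorBasis i := by
      rw [← map_smul, ← hM.toEuclideanLin_eigenvectorBasis]
      apply WithLp.ofLp_injective 2
      simp [adjugate_mul, Matrix.smul_mulVec]
    have h2 : M.det = hM.eigenvalues i * ∏ j ∈ Finset.univ.erase i, hM.eigenvalues j := by
      rw [Finset.mul_prod_erase _ _ (Finset.mem_univ i), hM.det_eq_prod_eigenvalues]
      rfl
    rw [h2, ← smul_smul] at h1
    exact smul_right_injective _ (hpos i).ne' h1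
  rw [hM.eigenvectorBasis.inner_map_eq_sum _ _ key,
    ← hM.eigenvectorBasis.sum_sq_norm_inner_right, Finset.mul_sum]
  refine Finset.sum_le_sum fun i _ => ?_
  rw [Real.norm_eq_abs, sq_abs]
  refine mul_le_mul_of_nonneg_right ?_ (sq_nonneg _)
  calc ∏ j ∈ Finset.univ.erase i, hM.eigenvalues j
      ≤ ∏ _j ∈ Finset.univ.erase i, Λ :=
        Finset.prod_le_prod (fun j _ => (hpos j).le)
          fun j _ => hup _ (hM.hasEigenvalue_eigenvalues j)
    _ = Λ ^ (d - 1) := by simp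

theorem toEuclideanLin_adjugate_eq (hdet : M.det ≠ 0) (v : EuclideanSpace ℝ (Fin d)) :
    toEuclideanLin M.adjugate v = M.det • toEuclideanLin M⁻¹ v := by
  rw [Matrix.inv_def, map_smul, LinearMap.smul_apply, smul_smul, Ring.mul_inverse_cancel _
    (isUnit_iff_ne_zero.2 hdet), one_smul]

theorem toEuclideanLin_inv_apply (hdet : M.det ≠ 0) (v : EuclideanSpace ℝ (Fin d)) :
    toEuclideanLin M (toEuclideanLin M⁻¹ v) = v := by
  apply WithLp.ofLp_injective 2
  simp [Matrix.mul_nonsing_inv _ (isUnit_iff_ne_zero.2 hdet)]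

theorem det_toEuclideanCLM : (toEuclideanCLM (𝕜 := ℝ) M).det = M.det := by
  rw [ContinuousLinearMap.det, coe_toEuclideanCLM_eq_toEuclideanLin,
    toEuclideanLin_eq_toLin_orthonormal, LinearMap.det_toLin]

end Matrix

/-! ### Minimal values as functions of the slope and of the perturbation. -/

section Envelope

variable {E : Type*} [NormedAddCommGroup E] [InnerProductSpace ℝ E]

/-- `T` selects minimizers over `K` of the functions `y ↦ f y - ⟪x, y⟫`. -/
def IsArgminSelection (K : Set E) (f : E → ℝ) (T : E → E) : Prop :=
  ∀ x, T x ∈ K ∧ ∀ y ∈ K, f (T x) - inner ℝ x (T x) ≤ f y - inner ℝ x y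

/-- The minimal value of `y ↦ f y - ⟪x, y⟫`, for a selection `T` of minimizers. -/
def minValue (f : E → ℝ) (T : E → E) (x : E) : ℝ := f (T x) - inner ℝ x (T x)

theorem exists_isArgminSelection {K : Set E} (hK : IsCompact K) (hne : K.Nonempty) {f : E → ℝ}
    (hf : ContinuousOn f K) : ∃ T, IsArgminSelection K f T := by
  have h1 : ∀ x : E, ∃ z ∈ K, ∀ y ∈ K, f z - inner ℝ x z ≤ f y - inner ℝ x y := fun x =>
    hK.exists_isMinOn hne (f := fun y => f y - inner ℝ x y) (by fun_prop)
  choose T hT hT' using h1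
  exact ⟨T, fun x => ⟨hT x, hT' x⟩⟩

variable {K : Set E} {f : E → ℝ} {T : E → E}

theorem IsArgminSelection.minValue_sub_le (hT : IsArgminSelection K f T) (x x' : E) :
    minValue f T x - minValue f T x' ≤ inner ℝ (x' - x) (T x') := by
  have := (hT x).2 (T x') (hT x').1
  rw [inner_sub_left]
  unfold minValue
  linarith

theorem IsArgminSelection.lipschitzWith (hT : IsArgminSelection K f T) {R : NNReal}
    (hR : ∀ y ∈ K, ‖y‖ ≤ R) : LipschitzWith R (minValue f T) := by
  refine LipschitzWith.of_le_add_mul R fun x x' => ?_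
  have h1 := hT.minValue_sub_le x x'
  have h2 := real_inner_le_norm (x' - x) (T x')
  have h3 := mul_le_mul_of_nonneg_left (hR _ (hT x').1) (norm_nonneg (x' - x))
  rw [dist_eq_norm, norm_sub_rev]
  linarith

/-- The affine function `x' ↦ f y - ⟪x', y⟫` lies above the minimal value and touches it at `x`, so
the two gradients agree there. -/
theorem IsArgminSelection.eq_neg_gradient [CompleteSpace E] (hT : IsArgminSelection K f T)
    {x y : E} (hd : DifferentiableAt ℝ (minValue f T) x) (hy : y ∈ K)
    (hmin : f y - inner ℝ x y ≤ minValue f T x) : y = -gradient (minValue f T) x := by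
  have h1 : IsLocalMin (fun x' => f y - inner ℝ x' y - minValue f T x') x := by
    refine Eventually.of_forall fun x' => ?_
    have := (hT x').2 y hy
    change f y - inner ℝ x y - minValue f T x ≤ f y - inner ℝ x' y - minValue f T x'
    unfold minValue at *
    linarith
  have h2 : HasFDerivAt (fun x' : E => inner ℝ x' y) (innerSL ℝ y) x := by
    have h := (innerSL ℝ y).hasFDerivAt (x := x)
    refine h.congr_of_eventuallyEq (Eventually.of_forall fun z => ?_)
    simp [real_inner_comm]
  have h3 := h1.hasFDerivAt_eq_zero ((h2.const_sub (f y)).sub hd.hasFDerivAt)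
  refine ext_inner_left ℝ fun v => ?_
  have h4 : -(inner ℝ y v) - fderiv ℝ (minValue f T) x v = 0 := by
    simpa using congrArg (fun L : E →L[ℝ] ℝ => L v) h3
  rw [inner_neg_right, real_inner_comm y v, real_inner_comm (gradient _ _) v, inner_gradient_left]
  linarith

theorem minValue_lipschitz_param {k : E → ℝ} {B : ℝ} (hB : ∀ y ∈ K, |k y| ≤ B)
    {S : ℝ → E → E} (hS : ∀ t, IsArgminSelection K (fun y => f y + t * k y) (S t)) (x : E)
    (s t : ℝ) :
    |minValue (fun y => f y + s * k y) (S s) x - minValue (fun y => f y + t * k y) (S t) x| ≤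
      B * |s - t| := by
  have aux : ∀ s t : ℝ, minValue (fun y => f y + s * k y) (S s) x -
      minValue (fun y => f y + t * k y) (S t) x ≤ B * |s - t| := by
    intro s t
    have h1 := (hS s x).2 _ (hS t x).1
    have h2 : (s - t) * k (S t x) ≤ B * |s - t| := by
      calc (s - t) * k (S t x) ≤ |(s - t) * k (S t x)| := le_abs_self _
        _ = |k (S t x)| * |s - t| := by rw [abs_mul, mul_comm]
        _ ≤ B * |s - t| := mul_le_mul_of_nonneg_right (hB _ (hS t x).1) (abs_nonneg _)
    unfold minValue
    linarith
  rw [abs_le]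
  refine ⟨?_, aux s t⟩
  have := aux t s
  rw [abs_sub_comm] at this
  linarith

/-- Danskin's theorem at a point with a unique minimizer. -/
theorem hasDerivAt_minValue (hK : IsCompact K) (hf : ContinuousOn f K) {k : E → ℝ}
    (hk : ContinuousOn k K)
    {S : ℝ → E → E} (hS : ∀ t, IsArgminSelection K (fun y => f y + t * k y) (S t)) (x : E)
    (t : ℝ) (huniq : ∀ y ∈ K, f y + t * k y - inner ℝ x y ≤
      minValue (fun y => f y + t * k y) (S t) x → y = S t x) :
    HasDerivAt (fun s => minValue (fun y => f y + s * k y) (S s) x) (k (S t x)) t := by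
  have hcont : ContinuousOn (fun p : ℝ × E => f p.2 + p.1 * k p.2 - inner ℝ x p.2)
      (Set.univ ×ˢ K) := by
    have h2 : Set.MapsTo (Prod.snd : ℝ × E → E) (Set.univ ×ˢ K) K := fun p hp => hp.2
    have hf' := hf.comp continuousOn_snd h2
    have hk' := hk.comp continuousOn_snd h2
    exact (hf'.add (continuousOn_fst.mul hk')).sub (by fun_prop)
  have hlim : Tendsto (fun s => S s x) (𝓝 t) (𝓝 (S t x)) := by
    -- By compactness it suffices that each cluster point is a minimizer at `t`. Otherwise a level
    -- `c` strictly separates its value from the minimum, and nearby `S s x` would lose to the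
    -- competitor `S t x`.
    refine hK.tendsto_nhds_of_unique_mapClusterPt (Eventually.of_forall fun s => (hS s x).1) ?_
    intro y hy hcl
    refine huniq y hy ?_
    by_contra! hlt
    obtain ⟨c, hc1, hc2⟩ := exists_between hlt
    have e1 : ∀ᶠ s in 𝓝 t, f (S t x) + s * k (S t x) - inner ℝ x (S t x) < c := by
      have : Tendsto (fun s => f (S t x) + s * k (S t x) - inner ℝ x (S t x)) (𝓝 t)
          (𝓝 (f (S t x) + t * k (S t x) - inner ℝ x (S t x))) := by
        apply Continuous.tendsto
        fun_prop
      exact this.eventually_lt_const hc1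
    have e2 : ∀ᶠ p in 𝓝[Set.univ ×ˢ K] (t, y), c < f p.2 + p.1 * k p.2 - inner ℝ x p.2 :=
      (hcont (t, y) ⟨trivial, hy⟩).tendsto.eventually_const_lt hc2
    rw [nhdsWithin_prod_eq, nhdsWithin_univ, Filter.eventually_prod_iff] at e2
    obtain ⟨p, hp, q, hq, hpq⟩ := e2
    have e3 : ∃ᶠ s in 𝓝 t, (S s x ∈ K → q (S s x)) :=
      hcl.frequently (p := fun z => z ∈ K → q z) (eventually_nhdsWithin_iff.1 hq)
    obtain ⟨s, hs1, hs2, hs3⟩ := (e3.and_eventually (e1.and hp)).exists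
    have h5 := hpq hs3 (hs1 (hS s x).1)
    have h6 := (hS s x).2 _ (hS t x).1
    simp only at h5 h6
    linarith
  have hklim : Tendsto (fun s => k (S s x)) (𝓝 t) (𝓝 (k (S t x))) :=
    (hk _ (hS t x).1).tendsto.comp
      (tendsto_nhdsWithin_iff.2 ⟨hlim, Eventually.of_forall fun s => (hS s x).1⟩)
  rw [hasDerivAt_iff_isLittleO, Asymptotics.isLittleO_iff]
  intro ε hε
  filter_upwards [Metric.tendsto_nhds.1 hklim ε hε] with s hs
  -- Testing each minimizer in the other problem places the increment of the minimal value between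
  -- `(s - t) * k (S s x)` and `(s - t) * k (S t x)`.
  have h1 := (hS s x).2 _ (hS t x).1
  have h2 := (hS t x).2 _ (hS s x).1
  rw [Real.dist_eq] at hs
  have h3 : |s - t| * |k (S s x) - k (S t x)| ≤ ε * |s - t| := by
    rw [mul_comm]
    exact mul_le_mul_of_nonneg_right hs.le (abs_nonneg _)
  rw [← abs_mul] at h3
  have h4 := neg_abs_le ((s - t) * (k (S s x) - k (S t x)))
  have h5 : 0 ≤ ε * |s - t| := by positivity
  simp only [minValue, smul_eq_mul, Real.norm_eq_abs] at *
  rw [abs_le]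
  constructor <;> linarith

variable [FiniteDimensional ℝ E] [MeasurableSpace E] [BorelSpace E]

theorem IsArgminSelection.ae_eq_neg_gradient {ν : Measure E} [ν.IsAddHaarMeasure]
    (hT : IsArgminSelection K f T) (hK : Bornology.IsBounded K) :
    ∀ᵐ x ∂ν, ∀ y ∈ K, f y - inner ℝ x y ≤ minValue f T x → y = -gradient (minValue f T) x := by
  obtain ⟨R, hR0, hR⟩ := hK.exists_pos_norm_le
  lift R to NNReal using hR0.le
  filter_upwards [(hT.lipschitzWith hR).ae_differentiableAt (μ := ν)] with x hx y hy hmin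
  exact hT.eq_neg_gradient hx hy hmin

theorem IsArgminSelection.ae_unique {ν : Measure E} [ν.IsAddHaarMeasure]
    (hT : IsArgminSelection K f T) (hK : Bornology.IsBounded K) :
    ∀ᵐ x ∂ν, ∀ y ∈ K, f y - inner ℝ x y ≤ minValue f T x → y = T x := by
  filter_upwards [hT.ae_eq_neg_gradient (ν := ν) hK] with x hx y hy hmin
  rw [hx y hy hmin, ← hx (T x) (hT x).1 le_rfl]

/-- The selection is an arbitrary choice, but almost everywhere it equals a gradient, which is
measurable. -/
theorem IsArgminSelection.aemeasurable {ν : Measure E} [ν.IsAddHaarMeasure]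
    (hT : IsArgminSelection K f T) (hK : Bornology.IsBounded K) : AEMeasurable T ν := by
  refine ⟨fun x => -gradient (minValue f T) x, ?_, ?_⟩
  · have h1 : Measurable (fderiv ℝ (minValue f T)) := measurable_fderiv ℝ _
    exact ((InnerProductSpace.toDual ℝ E).symm.continuous.measurable.comp h1).neg
  · filter_upwards [hT.ae_eq_neg_gradient (ν := ν) hK] with x hx
    exact hx _ (hT x).1 le_rfl

theorem hasDerivAt_integral_minValue (hK : IsCompact K) {ν : Measure E} [ν.IsAddHaarMeasure]
    {Ω : Set E} {w : E → ℝ} (hw : IntegrableOn w Ω ν)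
    (hf : ContinuousOn f K) {k : E → ℝ} (hk : Continuous k)
    {S : ℝ → E → E} (hS : ∀ t, IsArgminSelection K (fun y => f y + t * k y) (S t))
    (hint : ∀ t, IntegrableOn (fun x => minValue (fun y => f y + t * k y) (S t) x * w x) Ω ν)
    (t : ℝ) :
    IntegrableOn (fun x => k (S t x) * w x) Ω ν ∧
    HasDerivAt (fun s => ∫ x in Ω, minValue (fun y => f y + s * k y) (S s) x * w x ∂ν)
      (∫ x in Ω, k (S t x) * w x ∂ν) t := by
  obtain ⟨B, hB⟩ := hK.exists_bound_of_continuousOn hk.continuousOn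
  have hB0 : 0 ≤ B := (norm_nonneg _).trans (hB _ (hS 0 0).1)
  refine hasDerivAt_integral_of_dominated_loc_of_lip (bound := fun x => B * ‖w x‖) (s := Set.univ)
    univ_mem (Eventually.of_forall fun s => (hint s).aestronglyMeasurable) (hint t) ?_ ?_
    (hw.norm.const_mul B) ?_
  · have h1 : AEMeasurable (S t) (ν.restrict Ω) :=
      ((hS t).aemeasurable (ν := ν) hK.isBounded).mono_measure Measure.restrict_le_self
    exact (hk.measurable.comp_aemeasurable h1).aestronglyMeasurable.mul hw.aestronglyMeasurable
  · refine Eventually.of_forall fun x => LipschitzOnWith.of_dist_le_mul fun s _ r _ => ?_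
    rw [Real.dist_eq, Real.dist_eq, ← sub_mul, abs_mul, Real.coe_nnabs,
      abs_of_nonneg (by positivity : 0 ≤ B * ‖w x‖), Real.norm_eq_abs]
    have := mul_le_mul_of_nonneg_right (minValue_lipschitz_param (f := f) hB hS x s r)
      (abs_nonneg (w x))
    linarith
  · filter_upwards [ae_restrict_of_ae ((hS t).ae_unique (ν := ν) hK.isBounded)] with x hx
    exact (hasDerivAt_minValue hK hf hk.continuousOn hS x t hx).mul_const _

end Envelope

/-! ### Strong convexity and the response of minimizers to a perturbation. -/

section StrongConvexity

variable {E : Type*} [NormedAddCommGroup E] [InnerProductSpace ℝ E] [CompleteSpace E]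
  {Ω : Set E} {Φ : E → ℝ} {S : E → E} {A : E → E →L[ℝ] E} {lam : ℝ}

theorem HasGradientAt.hasDerivAt_line {Φ : E → ℝ} {g y v : E} {s : ℝ}
    (h : HasGradientAt Φ g (y + s • v)) :
    HasDerivAt (fun r : ℝ => Φ (y + r • v)) (inner ℝ g v) s := by
  have h1 : HasDerivAt (fun r : ℝ => y + r • v) v s := by
    simpa using ((hasDerivAt_id s).smul_const v).const_add y
  have h2 := h.hasFDerivAt.comp_hasDerivAt s h1
  exact h2.congr_deriv (by simp)

/-- Two integrations along the segment, in monotonicity form: `u` vanishes at `0` and has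
nonnegative derivative, and `w' = u`. -/
theorem strongly_convex_of_hasFDerivAt (hΩc : Convex ℝ Ω)
    (hΦ : ∀ y ∈ Ω, HasGradientAt Φ (S y) y) (hS : ∀ y ∈ Ω, HasFDerivAt S (A y) y)
    (hA : ∀ y ∈ Ω, ∀ v, lam * ‖v‖ ^ 2 ≤ inner ℝ v (A y v)) {y z : E} (hy : y ∈ Ω) (hz : z ∈ Ω) :
    Φ y + inner ℝ (S y) (z - y) + lam / 2 * ‖z - y‖ ^ 2 ≤ Φ z := by
  obtain ⟨v, rfl⟩ : ∃ v, z = y + v := ⟨z - y, by abel⟩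
  have hmem : ∀ s ∈ Set.Icc (0 : ℝ) 1, y + s • v ∈ Ω := fun s hs =>
    hΩc.add_smul_mem hy hz hs
  set u : ℝ → ℝ := fun s =>
    inner ℝ (S (y + s • v)) v - inner ℝ (S y) v - lam * ‖v‖ ^ 2 * s with hu
  have hu' : ∀ s ∈ Set.Icc (0 : ℝ) 1,
      HasDerivAt u (inner ℝ v (A (y + s • v) v) - lam * ‖v‖ ^ 2) s := by
    intro s hs
    have h1 : HasDerivAt (fun r : ℝ => y + r • v) v s := by
      simpa using ((hasDerivAt_id s).smul_const v).const_add y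
    have h2 := (hS _ (hmem s hs)).comp_hasDerivAt s h1
    have h3 := (h2.inner ℝ (hasDerivAt_const s v)).sub_const (inner ℝ (S y) v)
    have h4 := h3.sub ((hasDerivAt_id s).const_mul (lam * ‖v‖ ^ 2))
    refine HasDerivAt.congr_deriv (f := u) h4 ?_
    simp [real_inner_comm]
  have hmono : MonotoneOn u (Set.Icc 0 1) := by
    refine monotoneOn_of_deriv_nonneg (convex_Icc 0 1)
      (fun s hs => (hu' s hs).continuousAt.continuousWithinAt)
      (fun s hs => (hu' s (interior_subset hs)).differentiableAt.differentiableWithinAt) ?_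
    intro s hs
    rw [(hu' s (interior_subset hs)).deriv]
    linarith [hA _ (hmem s (interior_subset hs)) v]
  have hu0 : ∀ s ∈ Set.Icc (0 : ℝ) 1, 0 ≤ u s := fun s hs => by
    simpa [hu] using hmono ⟨le_rfl, zero_le_one⟩ hs hs.1
  set w : ℝ → ℝ := fun s =>
    Φ (y + s • v) - inner ℝ (S y) v * s - lam / 2 * ‖v‖ ^ 2 * s ^ 2 with hw
  have hw' : ∀ s ∈ Set.Icc (0 : ℝ) 1, HasDerivAt w (u s) s := by
    intro s hs
    have h1 := (hΦ _ (hmem s hs)).hasDerivAt_line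
    have h2 := (h1.sub ((hasDerivAt_id s).const_mul (inner ℝ (S y) v))).sub
      (((hasDerivAt_id s).pow 2).const_mul (lam / 2 * ‖v‖ ^ 2))
    refine HasDerivAt.congr_deriv (f := w) h2 ?_
    simp [hu]
    ring
  have hwmono : MonotoneOn w (Set.Icc 0 1) := by
    refine monotoneOn_of_deriv_nonneg (convex_Icc 0 1)
      (fun s hs => (hw' s hs).continuousAt.continuousWithinAt)
      (fun s hs => (hw' s (interior_subset hs)).differentiableAt.differentiableWithinAt) ?_
    intro s hs
    rw [(hw' s (interior_subset hs)).deriv]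
    exact hu0 s (interior_subset hs)
  have := hwmono (Set.left_mem_Icc.2 zero_le_one) (Set.right_mem_Icc.2 zero_le_one) zero_le_one
  simp [hw] at this
  rw [add_sub_cancel_left]
  linarith

theorem strongly_convex_closure (hΩc : Convex ℝ Ω)
    (hΦ : ∀ y ∈ Ω, HasGradientAt Φ (S y) y) (hS : ∀ y ∈ Ω, HasFDerivAt S (A y) y)
    (hA : ∀ y ∈ Ω, ∀ v, lam * ‖v‖ ^ 2 ≤ inner ℝ v (A y v)) (hcont : Continuous Φ)
    {y z : E} (hy : y ∈ Ω) (hz : z ∈ closure Ω) :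
    Φ y + inner ℝ (S y) (z - y) + lam / 2 * ‖z - y‖ ^ 2 ≤ Φ z := by
  have hcl : IsClosed {z | Φ y + inner ℝ (S y) (z - y) + lam / 2 * ‖z - y‖ ^ 2 ≤ Φ z} :=
    isClosed_le (by fun_prop) hcont
  exact closure_minimal (fun z hz => strongly_convex_of_hasFDerivAt hΩc hΦ hS hA hy hz) hcl hz

theorem injOn_of_strongly_monotone (hΩc : Convex ℝ Ω) (hlam : 0 < lam)
    (hΦ : ∀ y ∈ Ω, HasGradientAt Φ (S y) y) (hS : ∀ y ∈ Ω, HasFDerivAt S (A y) y)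
    (hA : ∀ y ∈ Ω, ∀ v, lam * ‖v‖ ^ 2 ≤ inner ℝ v (A y v)) : Set.InjOn S Ω := by
  intro y hy z hz hyz
  have h1 := strongly_convex_of_hasFDerivAt hΩc hΦ hS hA hy hz
  have h2 := strongly_convex_of_hasFDerivAt hΩc hΦ hS hA hz hy
  rw [← hyz, ← neg_sub, inner_neg_right, norm_neg] at h2
  have h3 : lam * ‖z - y‖ ^ 2 ≤ 0 := by linarith
  have h4 : ‖z - y‖ ^ 2 = 0 := le_antisymm (nonpos_of_mul_nonpos_right h3 hlam) (sq_nonneg _)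
  exact (sub_eq_zero.1 (norm_eq_zero.1 (pow_eq_zero_iff two_ne_zero |>.1 h4))).symm

/-- Moving from `y` to `z` costs at least `lam / 2 * ‖z - y‖ ^ 2` by strong convexity and gains at
most `|t| * L * ‖z - y‖` from the perturbation. The point `z` may lie on the boundary. -/
theorem norm_sub_le_of_minimizer_perturbed (hΩc : Convex ℝ Ω)
    (hΦ : ∀ y ∈ Ω, HasGradientAt Φ (S y) y) (hS : ∀ y ∈ Ω, HasFDerivAt S (A y) y)
    (hA : ∀ y ∈ Ω, ∀ v, lam * ‖v‖ ^ 2 ≤ inner ℝ v (A y v)) (hcont : Continuous Φ)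
    (hlam : 0 < lam) {k : E → ℝ} {L : NNReal} (hk : LipschitzWith L k)
    {y z : E} {t : ℝ} (hy : y ∈ Ω) (hz : z ∈ closure Ω)
    (hmin : Φ z + t * k z - inner ℝ (S y) z ≤ Φ y + t * k y - inner ℝ (S y) y) :
    ‖z - y‖ ≤ 2 * L / lam * |t| := by
  have h1 := strongly_convex_closure hΩc hΦ hS hA hcont hy hz
  have h2 := hk.dist_le_mul y z
  rw [Real.dist_eq, dist_eq_norm, norm_sub_rev] at h2
  have h3 : t * (k y - k z) ≤ |t| * (L * ‖z - y‖) := by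
    calc t * (k y - k z) ≤ |t * (k y - k z)| := le_abs_self _
      _ = |t| * |k y - k z| := abs_mul _ _
      _ ≤ _ := mul_le_mul_of_nonneg_left h2 (abs_nonneg _)
  rw [inner_sub_right] at h1
  have h4 : lam / 2 * ‖z - y‖ * ‖z - y‖ ≤ |t| * L * ‖z - y‖ := by nlinarith
  rcases (norm_nonneg (z - y)).eq_or_lt with h0 | h0
  · rw [← h0]
    positivity
  · have h5 := le_of_mul_le_mul_right h4 h0
    rw [div_mul_eq_mul_div, le_div_iff₀ hlam]
    linarith

/-- The mean value inequality along the segment needs only differentiability of `S` at `y`, not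
continuity of `A`. -/
theorem taylor_second_order_isLittleO (hΩo : IsOpen Ω)
    (hΦ : ∀ y ∈ Ω, HasGradientAt Φ (S y) y) (hS : ∀ y ∈ Ω, HasFDerivAt S (A y) y)
    {y : E} (hy : y ∈ Ω) :
    (fun v : E => Φ (y + v) - Φ y - inner ℝ (S y) v - inner ℝ v (A y v) / 2) =o[𝓝 0]
      fun v => ‖v‖ ^ 2 := by
  rw [Asymptotics.isLittleO_iff]
  intro ε hε
  have h1 := (hasFDerivAt_iff_isLittleO_nhds_zero.1 (hS y hy))
  rw [Asymptotics.isLittleO_iff] at h1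
  have h2 : ∀ᶠ v in 𝓝 (0 : E), y + v ∈ Ω := by
    have : Tendsto (fun v => y + v) (𝓝 0) (𝓝 y) := by
      simpa using (continuous_const_add y).tendsto 0
    exact this.eventually (hΩo.mem_nhds hy)
  obtain ⟨δ, hδ, hball⟩ := Metric.eventually_nhds_iff_ball.1 ((h1 hε).and h2)
  filter_upwards [Metric.ball_mem_nhds 0 hδ] with v hv
  have hmem : ∀ s ∈ Set.Icc (0 : ℝ) 1, s • v ∈ Metric.ball (0 : E) δ := fun s hs =>
    (convex_ball (0 : E) δ).smul_mem_of_zero_mem (Metric.mem_ball_self hδ) hv hs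
  set r : ℝ → ℝ := fun s =>
    Φ (y + s • v) - inner ℝ (S y) v * s - inner ℝ v (A y v) / 2 * s ^ 2 with hr
  have hr' : ∀ s ∈ Set.Icc (0 : ℝ) 1,
      HasDerivWithinAt r (inner ℝ (S (y + s • v) - S y - A y (s • v)) v) (Set.Icc 0 1) s := by
    intro s hs
    have h1 := (hΦ _ (hball _ (hmem s hs)).2).hasDerivAt_line
    have h2 := (h1.sub ((hasDerivAt_id s).const_mul (inner ℝ (S y) v))).sub
      (((hasDerivAt_id s).pow 2).const_mul (inner ℝ v (A y v) / 2))
    refine HasDerivAt.hasDerivWithinAt (HasDerivAt.congr_deriv (f := r) h2 ?_)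
    simp [inner_sub_right, inner_smul_right, real_inner_comm v]
    ring
  have hbound : ∀ s ∈ Set.Ico (0 : ℝ) 1,
      ‖(inner ℝ (S (y + s • v) - S y - A y (s • v)) v : ℝ)‖ ≤ ε * ‖v‖ ^ 2 := by
    intro s hs
    have hs' : s ∈ Set.Icc (0 : ℝ) 1 := ⟨hs.1, hs.2.le⟩
    calc ‖(inner ℝ (S (y + s • v) - S y - A y (s • v)) v : ℝ)‖
        ≤ ‖S (y + s • v) - S y - A y (s • v)‖ * ‖v‖ := norm_inner_le_norm _ _
      _ ≤ ε * ‖s • v‖ * ‖v‖ :=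
        mul_le_mul_of_nonneg_right (hball _ (hmem s hs')).1 (norm_nonneg _)
      _ = s * (ε * ‖v‖ ^ 2) := by
        rw [norm_smul, Real.norm_eq_abs, abs_of_nonneg hs.1]
        ring
      _ ≤ ε * ‖v‖ ^ 2 := mul_le_of_le_one_left (by positivity) hs.2.le
  have := norm_image_sub_le_of_norm_deriv_le_segment_01' hr' hbound
  simp only [hr, one_smul, zero_smul, add_zero] at this
  rw [norm_pow, norm_norm]
  refine le_trans (le_of_eq ?_) this
  congr 1
  ring

/-- Differentiability of perturbed minimizers in the direction of the perturbation. -/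
theorem hasDerivAt_comp_minimizer (hΩo : IsOpen Ω)
    (hΦ : ∀ y ∈ Ω, HasGradientAt Φ (S y) y) (hS : ∀ y ∈ Ω, HasFDerivAt S (A y) y)
    (hA : ∀ y ∈ Ω, ∀ v, lam * ‖v‖ ^ 2 ≤ inner ℝ v (A y v)) (hlam : 0 < lam)
    {k : E → ℝ} {y g w : E} (hy : y ∈ Ω) (hk : HasGradientAt k g y)
    (hsymm : ∀ u v, inner ℝ u (A y v) = inner ℝ v (A y u)) (hw : A y w = -g)
    {z : ℝ → E} {C : ℝ} (hz : ∀ t, ‖z t - y‖ ≤ C * |t|)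
    (hmin : ∀ t, ∀ y' ∈ Ω,
      Φ (z t) + t * k (z t) - inner ℝ (S y) (z t) ≤ Φ y' + t * k y' - inner ℝ (S y) y') :
    HasDerivAt (fun t => k (z t)) (inner ℝ g w) 0 := by
  set R : E → ℝ := fun v => Φ (y + v) - Φ y - inner ℝ (S y) v - inner ℝ v (A y v) / 2 with hR
  set ρ : E → ℝ := fun v => k (y + v) - k y - inner ℝ g v with hρ
  have hRo : R =o[𝓝 0] fun v => ‖v‖ ^ 2 := taylor_second_order_isLittleO hΩo hΦ hS hy
  have hρo : ρ =o[𝓝 0] fun v => v := by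
    have := hasFDerivAt_iff_isLittleO_nhds_zero.1 hk.hasFDerivAt
    simpa using this
  have hO1 : (fun t => z t - y) =O[𝓝 0] fun t : ℝ => t :=
    Asymptotics.IsBigO.of_bound C (Eventually.of_forall fun t => by simpa using hz t)
  have hO2 : (fun t : ℝ => t • w) =O[𝓝 0] fun t : ℝ => t :=
    Asymptotics.IsBigO.of_bound ‖w‖ (Eventually.of_forall fun t => by
      rw [norm_smul, mul_comm])
  have hlit : ∀ v : ℝ → E, v =O[𝓝 0] (fun t : ℝ => t) →
      (fun t => R (v t)) =o[𝓝 0] (fun t : ℝ => t ^ 2) ∧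
      (fun t => ρ (v t)) =o[𝓝 0] (fun t : ℝ => t) := by
    intro v hv
    have hv0 : Tendsto v (𝓝 0) (𝓝 0) := hv.trans_tendsto tendsto_id
    exact ⟨(hRo.comp_tendsto hv0).trans_isBigO (hv.norm_left.pow 2),
      (hρo.comp_tendsto hv0).trans_isBigO hv⟩
  obtain ⟨hR1, hρ1⟩ := hlit _ hO1
  obtain ⟨hR2, hρ2⟩ := hlit _ hO2
  have he : (fun t => R (t • w) - R (z t - y) + t * (ρ (t • w) - ρ (z t - y))) =o[𝓝 0]
      (fun t : ℝ => t ^ 2) := by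
    refine (hR2.sub hR1).add ?_
    have := (Asymptotics.isBigO_refl (fun t : ℝ => t) (𝓝 0)).mul_isLittleO (hρ2.sub hρ1)
    simpa [sq] using this
  have hmem : ∀ᶠ t : ℝ in 𝓝 0, y + t • w ∈ Ω := by
    have : Tendsto (fun t : ℝ => y + t • w) (𝓝 0) (𝓝 y) := by
      have h : Continuous (fun t : ℝ => y + t • w) := by fun_prop
      simpa using h.tendsto 0
    exact this.eventually (hΩo.mem_nhds hy)
  -- As `A y w = -g`, the model `v ↦ ⟪v, A y v⟫ / 2 + t * ⟪g, v⟫` is minimized at `t • w`. Testing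
  -- minimality of `z t` against `y + t • w` bounds the excess of the model at `z t - y` by the
  -- Taylor remainders, which are `o(t ^ 2)`.
  have hkey : (fun t => ‖z t - y - t • w‖ ^ 2) =O[𝓝 0]
      (fun t => R (t • w) - R (z t - y) + t * (ρ (t • w) - ρ (z t - y))) := by
    refine Asymptotics.IsBigO.of_bound (2 / lam) ?_
    filter_upwards [hmem] with t ht
    have h1 := hmin t _ ht
    have h2 := hA y hy (z t - y - t • w)
    have h3 := hsymm (t • w) (z t - y)
    have h4 : R (z t - y) = Φ (z t) - Φ y - inner ℝ (S y) (z t - y)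
      - inner ℝ (z t - y) (A y (z t - y)) / 2 := by simp [hR]
    have h5 : ρ (z t - y) = k (z t) - k y - inner ℝ g (z t - y) := by simp [hρ]
    have h6 : R (t • w) = Φ (y + t • w) - Φ y - inner ℝ (S y) (t • w)
      - inner ℝ (t • w) (A y (t • w)) / 2 := rfl
    have h7 : ρ (t • w) = k (y + t • w) - k y - inner ℝ g (t • w) := rfl
    have h8 : inner ℝ (z t - y) (A y (t • w)) = -(t * inner ℝ g (z t - y)) := by
      rw [map_smul, hw, inner_smul_right, inner_neg_right, real_inner_comm]
      ring
    have h9 : inner ℝ (t • w) (A y (t • w)) = -(t * inner ℝ g (t • w)) := by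
      rw [map_smul, hw, inner_smul_right, inner_neg_right, real_inner_comm g]
      ring
    have h10 : inner ℝ (S y) (y + t • w) = inner ℝ (S y) y + inner ℝ (S y) (t • w) :=
      inner_add_right _ _ _
    have h11 : inner ℝ (S y) (z t - y) = inner ℝ (S y) (z t) - inner ℝ (S y) y :=
      inner_sub_right _ _ _
    have h12 : inner ℝ (z t - y - t • w) (A y (z t - y - t • w)) =
        inner ℝ (z t - y) (A y (z t - y)) - inner ℝ (z t - y) (A y (t • w))
        - (inner ℝ (t • w) (A y (z t - y)) - inner ℝ (t • w) (A y (t • w))) := by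
      rw [map_sub, inner_sub_right, inner_sub_left (z t - y) (t • w),
        inner_sub_left (z t - y) (t • w)]
      ring
    have h13 : lam / 2 * ‖z t - y - t • w‖ ^ 2 ≤
        R (t • w) - R (z t - y) + t * (ρ (t • w) - ρ (z t - y)) := by
      rw [h4, h5, h6, h7]
      linarith
    rw [norm_pow, norm_norm, div_mul_eq_mul_div, le_div_iff₀ hlam]
    have := h13.trans (Real.le_norm_self _)
    linarith
  have hv : (fun t => z t - y - t • w) =o[𝓝 0] (fun t : ℝ => t) := by
    have := (hkey.trans_isLittleO he)
    exact (Asymptotics.IsLittleO.of_pow this two_ne_zero).of_norm_left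
  have hz0 : z 0 = y := by
    have := hz 0
    simpa [sub_eq_zero] using this
  rw [hasDerivAt_iff_isLittleO]
  have hfin : (fun t => inner ℝ g (z t - y - t • w) + ρ (z t - y)) =o[𝓝 0] (fun t : ℝ => t) := by
    refine Asymptotics.IsLittleO.add ?_ hρ1
    refine Asymptotics.IsBigO.trans_isLittleO ?_ hv
    exact Asymptotics.IsBigO.of_bound ‖g‖ (Eventually.of_forall fun t => norm_inner_le_norm _ _)
  refine hfin.congr (fun t => ?_) (fun t => by simp)
  simp only [hρ, hz0, add_sub_cancel, inner_sub_right, inner_smul_right, smul_eq_mul, sub_zero]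
  ring

end StrongConvexity

theorem IsLocalMin.gradient_eq {E : Type*} [NormedAddCommGroup E] [InnerProductSpace ℝ E]
    [CompleteSpace E] {Φ : E → ℝ} {x y s : E} (h : IsLocalMin (fun z => Φ z - inner ℝ x z) y)
    (hs : HasGradientAt Φ s y) : s = x := by
  have h1 := h.hasFDerivAt_eq_zero (hs.hasFDerivAt.sub (innerSL ℝ x).hasFDerivAt)
  refine ext_inner_right ℝ fun v => ?_
  have := congrArg (fun L : E →L[ℝ] ℝ => L v) h1
  simpa [sub_eq_zero] using this

/-! ### Regularity of `c`-convex functions and the range of the gradient map. -/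

section CTransform

variable {d : ℕ} {Ω : Set (EuclideanSpace ℝ (Fin d))} {τ : ℝ}
  {φ f : EuclideanSpace ℝ (Fin d) → ℝ} {T : EuclideanSpace ℝ (Fin d) → EuclideanSpace ℝ (Fin d)}

/-- A supremum of functions `y ↦ φ^c(x) - ‖x - y‖² / (2τ)`, each Lipschitz on `Ω` with constant
`diam Ω / τ`, has the same constant. -/
theorem IsCConvex.exists_lipschitzOnWith (hφ : IsCConvex Ω τ φ) (hτ : 0 < τ)
    (hΩ : Bornology.IsBounded Ω) : ∃ L, LipschitzOnWith L φ Ω := by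
  rcases Ω.eq_empty_or_nonempty with rfl | ⟨y₀, hy₀⟩
  · exact ⟨0, by simp⟩
  have hD : ∀ x ∈ Ω, ∀ y ∈ Ω, ‖x - y‖ ≤ Metric.diam Ω := fun x hx y hy => by
    rw [← dist_eq_norm]
    exact Metric.dist_le_diam_of_mem hΩ hx hy
  set D := Metric.diam Ω
  have hD0 : 0 ≤ D := Metric.diam_nonneg
  have hcost : ∀ x ∈ Ω, ∀ y ∈ Ω, ‖x - y‖ ^ 2 / (2 * τ) ≤ D ^ 2 / (2 * τ) := fun x hx y hy => by
    have := hD x hx y hy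
    gcongr
  have hcost0 : ∀ x y : EuclideanSpace ℝ (Fin d), 0 ≤ ‖x - y‖ ^ 2 / (2 * τ) := fun x y => by
    positivity
  -- If `φ` were unbounded below, the default value of `⨅` would make `φ^c` zero on `Ω`; the choice
  -- `x = y` in the supremum then gives `φ y ≥ 0`, a contradiction.
  have hbelow : ∃ m, ∀ y ∈ Ω, m ≤ φ y := by
    by_contra! hno
    have hzero : ∀ x ∈ Ω, backwardCTransform Ω τ φ x = 0 := by
      intro x hx
      refine Real.iInf_of_not_bddBelow ?_
      rintro ⟨m, hm⟩
      obtain ⟨y, hy, hlt⟩ := hno (m - D ^ 2 / (2 * τ))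
      have h1 := hm ⟨⟨y, hy⟩, rfl⟩
      have h2 := hcost x hx y hy
      simp only at h1
      linarith
    obtain ⟨y, hy, hlt⟩ := hno 0
    have h1 := hφ.2 y hy
    have h2 : backwardCTransform Ω τ φ y - ‖y - y‖ ^ 2 / (2 * τ) ≤
        forwardCTransform Ω τ (backwardCTransform Ω τ φ) y := by
      refine le_ciSup (f := fun x : Ω => backwardCTransform Ω τ φ x -
        ‖(x : EuclideanSpace ℝ (Fin d)) - y‖ ^ 2 / (2 * τ)) ⟨0, ?_⟩ ⟨y, hy⟩
      rintro _ ⟨x, rfl⟩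
      have := hcost0 x y
      simp only [hzero x x.2]
      linarith
    rw [hzero y hy, sub_self, norm_zero] at h2
    norm_num at h2
    linarith
  obtain ⟨m, hm⟩ := hbelow
  have hupper : ∀ x ∈ Ω, backwardCTransform Ω τ φ x ≤ φ y₀ + D ^ 2 / (2 * τ) := by
    intro x hx
    have h1 : backwardCTransform Ω τ φ x ≤ φ y₀ + ‖x - y₀‖ ^ 2 / (2 * τ) := by
      refine ciInf_le (f := fun y : Ω => φ y +
        ‖x - (y : EuclideanSpace ℝ (Fin d))‖ ^ 2 / (2 * τ)) ⟨m, ?_⟩ ⟨y₀, hy₀⟩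
      rintro _ ⟨y, rfl⟩
      have h1 := hcost0 x y
      have h2 := hm y y.2
      simp only
      linarith
    linarith [hcost x hx y₀ hy₀]
  have hlip : ∀ y ∈ Ω, ∀ y' ∈ Ω, φ y ≤ φ y' + D / τ * ‖y - y'‖ := by
    intro y hy y' hy'
    rw [← hφ.2 y hy]
    have : Nonempty Ω := ⟨⟨y₀, hy₀⟩⟩
    refine ciSup_le fun x => ?_
    have h1 : backwardCTransform Ω τ φ x - ‖(x : EuclideanSpace ℝ (Fin d)) - y'‖ ^ 2 / (2 * τ) ≤
        φ y' := by
      rw [← hφ.2 y' hy']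
      refine le_ciSup (f := fun x : Ω => backwardCTransform Ω τ φ x -
        ‖(x : EuclideanSpace ℝ (Fin d)) - y'‖ ^ 2 / (2 * τ)) ⟨φ y₀ + D ^ 2 / (2 * τ), ?_⟩ x
      rintro _ ⟨x, rfl⟩
      have h1 := hcost0 x y'
      have h2 := hupper x x.2
      simp only
      linarith
    have h2 : ‖(x : EuclideanSpace ℝ (Fin d)) - y'‖ ≤ ‖(x : EuclideanSpace ℝ (Fin d)) - y‖ +
        ‖y - y'‖ := norm_sub_le_norm_sub_add_norm_sub _ _ _
    have h3 := hD x x.2 y hy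
    have h4 := hD x x.2 y' hy'
    have h5 : ‖(x : EuclideanSpace ℝ (Fin d)) - y'‖ ^ 2 ≤
        ‖(x : EuclideanSpace ℝ (Fin d)) - y‖ ^ 2 + 2 * D * ‖y - y'‖ := by
      have h6 := norm_nonneg ((x : EuclideanSpace ℝ (Fin d)) - y)
      have h7 := norm_nonneg ((x : EuclideanSpace ℝ (Fin d)) - y')
      have h8 := norm_nonneg (y - y')
      nlinarith
    have h6 : ‖(x : EuclideanSpace ℝ (Fin d)) - y'‖ ^ 2 / (2 * τ) ≤
        ‖(x : EuclideanSpace ℝ (Fin d)) - y‖ ^ 2 / (2 * τ) + D / τ * ‖y - y'‖ := by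
      calc _ ≤ (‖(x : EuclideanSpace ℝ (Fin d)) - y‖ ^ 2 + 2 * D * ‖y - y'‖) / (2 * τ) := by
            gcongr
        _ = _ := by field_simp
    linarith
  refine ⟨⟨D / τ, by positivity⟩, LipschitzOnWith.of_le_add_mul _ fun y hy y' hy' => ?_⟩
  rw [dist_eq_norm]
  exact hlip y hy y' hy'

theorem add_cost_eq (hτ : 0 < τ) (a : ℝ) (x y : EuclideanSpace ℝ (Fin d)) :
    a + ‖x - y‖ ^ 2 / (2 * τ) =
      ‖x‖ ^ 2 / (2 * τ) + (‖y‖ ^ 2 / 2 + τ * a - inner ℝ x y) / τ := by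
  rw [norm_sub_sq_real]
  field_simp
  ring

/-- By continuity of `f`, the infimum over `Ω` equals the minimum over its closure. -/
theorem backwardCTransform_eq_minValue (hτ : 0 < τ) (hne : Ω.Nonempty) (hf : Continuous f)
    (hfφ : Set.EqOn φ f Ω) {Φ : EuclideanSpace ℝ (Fin d) → ℝ}
    (hΦ : ∀ y, Φ y = ‖y‖ ^ 2 / 2 + τ * f y)
    (hT : IsArgminSelection (closure Ω) Φ T) (x : EuclideanSpace ℝ (Fin d)) :
    backwardCTransform Ω τ φ x = ‖x‖ ^ 2 / (2 * τ) + minValue Φ T x / τ := by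
  have hval : ∀ y, ‖x‖ ^ 2 / (2 * τ) + (Φ y - inner ℝ x y) / τ =
      f y + ‖x - y‖ ^ 2 / (2 * τ) := fun y => by rw [hΦ, add_cost_eq hτ]
  have hle : ∀ y ∈ Ω, ‖x‖ ^ 2 / (2 * τ) + minValue Φ T x / τ ≤
      φ y + ‖x - y‖ ^ 2 / (2 * τ) := fun y hy => by
    rw [hfφ hy, ← hval y]
    have := (hT x).2 y (subset_closure hy)
    unfold minValue
    gcongr
  have : Nonempty Ω := hne.to_subtype
  refine le_antisymm ?_ (le_ciInf fun y => hle y y.2)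
  have hcl : IsClosed {y | backwardCTransform Ω τ φ x ≤ f y + ‖x - y‖ ^ 2 / (2 * τ)} :=
    isClosed_le continuous_const (by fun_prop)
  have hsub : Ω ⊆ {y | backwardCTransform Ω τ φ x ≤ f y + ‖x - y‖ ^ 2 / (2 * τ)} := by
    intro y hy
    change backwardCTransform Ω τ φ x ≤ f y + ‖x - y‖ ^ 2 / (2 * τ)
    rw [← hfφ hy]
    refine ciInf_le (f := fun y : Ω => φ y +
      ‖x - (y : EuclideanSpace ℝ (Fin d))‖ ^ 2 / (2 * τ)) ⟨‖x‖ ^ 2 / (2 * τ) + minValue Φ T x / τ, ?_⟩ ⟨y, hy⟩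
    rintro _ ⟨y, rfl⟩
    exact hle y y.2
  have := closure_minimal hsub hcl (hT x).1
  rwa [Set.mem_ofPred_eq, ← hval] at this

/-- The supremum giving `φ^{c c̄}(y) = φ y` is dominated by a maximum attained at some `x` in the
closure. Then `y` minimizes `Φ - ⟪x, ·⟫`, so `x` is the gradient of `Φ` at `y`. -/
theorem IsCConvex.gradient_mem_closure (hφ : IsCConvex Ω τ φ) (hτ : 0 < τ) (hΩo : IsOpen Ω)
    (hΩb : Bornology.IsBounded Ω) (hf : Continuous f)
    (hfφ : Set.EqOn φ f Ω) {Φ : EuclideanSpace ℝ (Fin d) → ℝ}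
    (hΦ : ∀ y, Φ y = ‖y‖ ^ 2 / 2 + τ * f y)
    (hT : IsArgminSelection (closure Ω) Φ T) {y s : EuclideanSpace ℝ (Fin d)} (hy : y ∈ Ω)
    (hs : HasGradientAt Φ s y) : s ∈ closure Ω := by
  have hne : Ω.Nonempty := ⟨y, hy⟩
  have : Nonempty Ω := hne.to_subtype
  obtain ⟨R, hR0, hR⟩ := hΩb.closure.exists_pos_norm_le
  lift R to NNReal using hR0.le
  have hG : Continuous (minValue Φ T) := (hT.lipschitzWith hR).continuous
  obtain ⟨x, hx, hmax⟩ := hΩb.isCompact_closure.exists_isMaxOn hne.closure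
    (f := fun x => ‖x‖ ^ 2 / (2 * τ) + minValue Φ T x / τ - ‖x - y‖ ^ 2 / (2 * τ)) (by fun_prop)
  have h1 : f y ≤ ‖x‖ ^ 2 / (2 * τ) + minValue Φ T x / τ - ‖x - y‖ ^ 2 / (2 * τ) := by
    rw [← hfφ hy, ← hφ.2 y hy]
    refine ciSup_le fun z => ?_
    rw [backwardCTransform_eq_minValue hτ hne hf hfφ hΦ hT]
    exact hmax (subset_closure z.2)
  have h2 : Φ y - inner ℝ x y ≤ minValue Φ T x := by
    have h3 := add_cost_eq hτ (f y) x y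
    rw [← hΦ] at h3
    have h4 : (Φ y - inner ℝ x y) / τ ≤ minValue Φ T x / τ := by linarith
    exact (div_le_div_iff_of_pos_right hτ).1 h4
  have h3 : IsLocalMin (fun z => Φ z - inner ℝ x z) y := by
    filter_upwards [hΩo.mem_nhds hy] with z hz
    exact h2.trans ((hT x).2 z (subset_closure hz))
  rwa [h3.gradient_eq hs]

end CTransform

/-- A surjective strict derivative makes `S` open at `y`, so `S y` is interior to `closure Ω`; an
open convex set is the interior of its closure. -/
theorem mem_of_mapsTo_closure {E : Type*} [NormedAddCommGroup E] [NormedSpace ℝ E]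
    [CompleteSpace E] {Ω : Set E} (hΩo : IsOpen Ω) (hΩc : Convex ℝ Ω) {S : E → E}
    (hmap : Set.MapsTo S Ω (closure Ω)) {y : E} (hy : y ∈ Ω) {A : E →L[ℝ] E}
    (hS : HasStrictFDerivAt S A y) (hA : Function.Surjective A) : S y ∈ Ω := by
  have h1 : S '' Ω ∈ 𝓝 (S y) := by
    rw [← hS.map_nhds_eq_of_surj (LinearMap.range_eq_top.2 hA)]
    exact image_mem_map (hΩo.mem_nhds hy)
  have h2 : S y ∈ interior (closure Ω) :=
    mem_interior_iff_mem_nhds.2 (mem_of_superset h1 hmap.image_subset)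
  rwa [hΩc.interior_closure_eq_interior_of_nonempty_interior
    ⟨y, by rwa [hΩo.interior_eq]⟩, hΩo.interior_eq] at h2

/-! ### The derivative of `y + τ ∇φ(y)` as a matrix. -/

section MapJacobian

variable {d : ℕ} {Ω : Set (EuclideanSpace ℝ (Fin d))} {φ : EuclideanSpace ℝ (Fin d) → ℝ}
  {y : EuclideanSpace ℝ (Fin d)}

theorem hessianMatrix_isHermitian (hφ : ContDiffAt ℝ 2 φ y) : (hessianMatrix φ y).IsHermitian := by
  ext i j
  have h : IsSymmSndFDerivAt ℝ φ y := hφ.isSymmSndFDerivAt (by simp)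
  simpa [hessianMatrix] using h _ _

theorem mapJacobian_isHermitian (τ : ℝ) (hφ : ContDiffAt ℝ 2 φ y) :
    (mapJacobian τ φ y).IsHermitian := by
  have h := hessianMatrix_isHermitian hφ
  unfold mapJacobian
  rw [Matrix.IsHermitian, Matrix.conjTranspose_add, Matrix.conjTranspose_smul, h.eq]
  simp

theorem inner_toEuclideanLin_hessianMatrix (v w : EuclideanSpace ℝ (Fin d)) :
    inner ℝ v (Matrix.toEuclideanLin (hessianMatrix φ y) w) = fderiv ℝ (fderiv ℝ φ) y v w := by
  have hexp : ∀ u : EuclideanSpace ℝ (Fin d), u = ∑ i, u i • EuclideanSpace.single i (1 : ℝ) := by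
    intro u
    simpa using ((EuclideanSpace.basisFun (Fin d) ℝ).sum_repr u).symm
  conv_rhs => rw [hexp v, hexp w]
  simp only [map_sum, map_smul, _root_.sum_apply, _root_.smul_apply]
  simp [PiLp.inner_apply, Matrix.mulVec, dotProduct, hessianMatrix, Finset.mul_sum, Finset.sum_mul]
  rw [Finset.sum_comm]
  refine Finset.sum_congr rfl fun i _ => Finset.sum_congr rfl fun j _ => ?_
  ring

theorem hasStrictFDerivAt_id_add_gradient (τ : ℝ) (hφ : ContDiffAt ℝ 2 φ y) :
    HasStrictFDerivAt (fun z => z + τ • gradient φ z)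
      (Matrix.toEuclideanCLM (𝕜 := ℝ) (mapJacobian τ φ y)) y := by
  have h1 : HasStrictFDerivAt (fderiv ℝ φ) (fderiv ℝ (fderiv ℝ φ) y) y :=
    (hφ.fderiv_right (m := 1) (by norm_num)).hasStrictFDerivAt (by norm_num)
  -- The inverse Riesz map, formally conjugate-linear, repackaged as a real-linear one.
  let J : (EuclideanSpace ℝ (Fin d) →L[ℝ] ℝ) →L[ℝ] EuclideanSpace ℝ (Fin d) :=
    ⟨{ toFun := fun l => (InnerProductSpace.toDual ℝ _).symm l
       map_add' := fun a b => map_add _ a b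
       map_smul' := fun c a => by simp },
      (InnerProductSpace.toDual ℝ (EuclideanSpace ℝ (Fin d))).symm.continuous⟩
  have h2 : HasStrictFDerivAt (gradient φ) (J.comp (fderiv ℝ (fderiv ℝ φ) y)) y :=
    J.hasStrictFDerivAt.comp y h1
  refine ((hasStrictFDerivAt_id y).add (h2.const_smul τ)).congr_fderiv ?_
  ext1 v
  refine ext_inner_left ℝ fun u => ?_
  have h3 : inner ℝ u (J (fderiv ℝ (fderiv ℝ φ) y v)) = fderiv ℝ (fderiv ℝ φ) y v u := by
    rw [real_inner_comm]
    exact InnerProductSpace.toDual_symm_apply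
  have hsymm : IsSymmSndFDerivAt ℝ φ y := hφ.isSymmSndFDerivAt (by simp)
  have h4 := inner_toEuclideanLin_hessianMatrix (φ := φ) (y := y) u v
  have h5 : Matrix.toEuclideanCLM (𝕜 := ℝ) (mapJacobian τ φ y) v =
      v + τ • Matrix.toEuclideanLin (hessianMatrix φ y) v := by
    rw [mapJacobian, map_add, map_smul, map_one]
    rfl
  rw [h5, inner_add_right, inner_smul_right, h4, hsymm u v]
  simp [inner_add_right, inner_smul_right, h3]

theorem hasGradientAt_sq_norm_add {f : EuclideanSpace ℝ (Fin d) → ℝ} (τ : ℝ)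
    (hφ : DifferentiableAt ℝ φ y) (hf : f =ᶠ[𝓝 y] φ) :
    HasGradientAt (fun z => ‖z‖ ^ 2 / 2 + τ * f z) (y + τ • gradient φ y) y := by
  have h1 : HasFDerivAt f (fderiv ℝ φ y) y := hφ.hasFDerivAt.congr_of_eventuallyEq hf
  have h2 := ((hasStrictFDerivAt_norm_sq y).hasFDerivAt.mul_const (1 / 2)).add (h1.const_mul τ)
  have h3 : HasFDerivAt (fun z => ‖z‖ ^ 2 / 2 + τ * f z) _ y :=
    h2.congr_of_eventuallyEq (Eventually.of_forall fun z => by simp [div_eq_mul_inv])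
  rw [hasGradientAt_iff_hasFDerivAt]
  refine h3.congr_fderiv ?_
  ext v
  simp

end MapJacobian

/-! ### Change of variables and differentiation along minimizers. -/

section ChangeOfVariables

variable {E : Type*} [NormedAddCommGroup E] [InnerProductSpace ℝ E] [FiniteDimensional ℝ E]
  [MeasurableSpace E] [BorelSpace E] {ν : Measure E} [ν.IsAddHaarMeasure]
  {Ω : Set E} {Φ : E → ℝ} {S : E → E} {A : E → E →L[ℝ] E} {lam : ℝ}

/-- A property that holds almost everywhere can be pulled back along an injective differentiable
map with invertible derivative. -/
theorem ae_restrict_comp_of_det_ne_zero (hΩ : MeasurableSet Ω)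
    (hS : ∀ y ∈ Ω, HasFDerivAt S (A y) y) (hinj : Set.InjOn S Ω) (hmap : Set.MapsTo S Ω Ω)
    (hdet : ∀ y ∈ Ω, (A y).det ≠ 0) {P : E → Prop} (hP : ∀ᵐ x ∂(ν.restrict Ω), P x) :
    ∀ᵐ y ∂(ν.restrict Ω), P (S y) := by
  classical
  rw [ae_restrict_iff' hΩ] at hP ⊢
  obtain ⟨Z, hZsub, hZm, hZ0⟩ := exists_measurable_superset_of_null (ae_iff.1 hP)
  have hSc : ContinuousOn S Ω := fun y hy => (hS y hy).continuousAt.continuousWithinAt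
  have hpm : Measurable (Ω.piecewise S 0) := hSc.measurable_piecewise continuousOn_const hΩ
  have hs : MeasurableSet (Ω ∩ Ω.piecewise S 0 ⁻¹' Z) := hΩ.inter (hpm hZm)
  set s := Ω ∩ Ω.piecewise S 0 ⁻¹' Z with hs_def
  have himg : S '' s ⊆ Z := by
    rintro _ ⟨y, ⟨hy, hyZ⟩, rfl⟩
    rwa [Set.mem_preimage, Set.piecewise_eq_of_mem _ _ _ hy] at hyZ
  have hder : ∀ y ∈ s, HasFDerivWithinAt S (A y) s y := fun y hy =>
    (hS y hy.1).hasFDerivWithinAt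
  -- The integral of `|det A|` over `s` is the measure of `S '' s`, which is zero; as `det A` never
  -- vanishes, `s` is null.
  have h1 := lintegral_abs_det_fderiv_eq_addHaar_image ν hs hder (hinj.mono fun y hy => hy.1)
  rw [measure_mono_null himg hZ0,
    lintegral_eq_zero_iff' (aemeasurable_ofReal_abs_det_fderivWithin ν hs hder)] at h1
  have h2 := (ae_restrict_iff' hs).1 h1
  filter_upwards [h2] with y hy hyΩ
  by_contra hno
  have hyZ : S y ∈ Z := hZsub (by
    change ¬ (S y ∈ Ω → P (S y))
    exact fun h => hno (h (hmap hyΩ)))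
  have h3 := hy ⟨hyΩ, by
    rwa [Set.mem_preimage, Set.piecewise_eq_of_mem _ _ _ hyΩ]⟩
  simp only [Pi.zero_apply, ENNReal.ofReal_eq_zero] at h3
  exact (abs_pos.2 (hdet y hyΩ)).not_ge h3

/-- The derivative at `0` of the integral of a perturbation along its own minimizers. -/
theorem hasDerivAt_integral_comp_argmin (hΩo : IsOpen Ω) (hΩc : Convex ℝ Ω) (hlam : 0 < lam)
    (hΦ : ∀ y ∈ Ω, HasGradientAt Φ (S y) y) (hS : ∀ y ∈ Ω, HasFDerivAt S (A y) y)
    (hA : ∀ y ∈ Ω, ∀ v, lam * ‖v‖ ^ 2 ≤ inner ℝ v (A y v)) (hcont : Continuous Φ)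
    (hsymm : ∀ y ∈ Ω, ∀ u v, inner ℝ u (A y v) = inner ℝ v (A y u))
    {B : E → E → E} (hB : ∀ y ∈ Ω, ∀ v, A y (B y v) = v)
    (hmap : Set.MapsTo S Ω Ω) {k : E → ℝ} {L : NNReal} (hk : LipschitzWith L k)
    {w : E → ℝ} (hw : IntegrableOn w Ω ν)
    (hwS : ∀ᵐ x ∂(ν.restrict Ω), w x = 0 ∨ x ∈ S '' Ω) {T : ℝ → E → E}
    (hT : ∀ t, IsArgminSelection (closure Ω) (fun y => Φ y + t * k y) (T t))
    (hint : ∀ t, IntegrableOn (fun x => k (T t x) * w x) Ω ν) :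
    HasDerivAt (fun t => ∫ x in Ω, k (T t x) * w x ∂ν)
      (-∫ y in Ω, |(A y).det| * (inner ℝ (gradient k y) (B y (gradient k y)) * w (S y)) ∂ν) 0 := by
  have hdist : ∀ y ∈ Ω, ∀ t, ‖T t (S y) - y‖ ≤ 2 * L / lam * |t| := fun y hy t =>
    norm_sub_le_of_minimizer_perturbed hΩc hΦ hS hA hcont hlam hk hy (hT t (S y)).1
      ((hT t (S y)).2 y (subset_closure hy))
  have hT0 : ∀ y ∈ Ω, T 0 (S y) = y := fun y hy => by
    simpa [sub_eq_zero] using hdist y hy 0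
  have hinj := injOn_of_strongly_monotone hΩc hlam hΦ hS hA
  set V : E → ℝ := fun x =>
    -inner ℝ (gradient k (T 0 x)) (B (T 0 x) (gradient k (T 0 x))) * w x with hV
  have hderiv : ∀ y ∈ Ω, DifferentiableAt ℝ k y →
      HasDerivAt (fun t => k (T t (S y))) (-inner ℝ (gradient k y) (B y (gradient k y))) 0 := by
    intro y hy hky
    have h := hasDerivAt_comp_minimizer (z := fun t => T t (S y)) (w := -B y (gradient k y))
      hΩo hΦ hS hA hlam hy hky.hasGradientAt (hsymm y hy)
      (by rw [map_neg, hB y hy]) (hdist y hy)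
      (fun t y' hy' => (hT t (S y)).2 y' (subset_closure hy'))
    simpa using h
  -- Rademacher's theorem discards a null set of `y`; its image under the differentiable map `S` is
  -- a null set of `x`.
  have hnull : ∀ᵐ x ∂(ν.restrict Ω), ∀ y ∈ Ω, S y = x → DifferentiableAt ℝ k y := by
    refine ae_restrict_of_ae ?_
    have h1 : ν {y | y ∈ Ω ∧ ¬ DifferentiableAt ℝ k y} = 0 :=
      measure_mono_null (fun y hy => hy.2) (ae_iff.1 (hk.ae_differentiableAt (μ := ν)))
    have h2 := addHaar_image_eq_zero_of_differentiableOn_of_addHaar_eq_zero ν (f := S)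
      (fun y hy => (hS y hy.1).differentiableAt.differentiableWithinAt) h1
    filter_upwards [measure_eq_zero_iff_ae_notMem.1 h2] with x hx y hy hyx
    by_contra hno
    exact hx ⟨y, ⟨hy, hno⟩, hyx⟩
  have hlim : Tendsto (fun t : ℝ => ∫ x in Ω, t⁻¹ * (k (T t x) * w x - k (T 0 x) * w x) ∂ν)
      (𝓝[≠] 0) (𝓝 (∫ x in Ω, V x ∂ν)) := by
    refine tendsto_integral_filter_of_dominated_convergence
      (fun x => L * (2 * L / lam) * ‖w x‖) ?_ ?_ (hw.norm.const_mul _) ?_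
    · exact Eventually.of_forall fun t => (((hint t).sub (hint 0)).const_mul _).aestronglyMeasurable
    · filter_upwards [self_mem_nhdsWithin] with t ht
      have ht0 : 0 < |t| := abs_pos.2 ht
      filter_upwards [hwS] with x hx
      rcases hx with hx | ⟨y, hy, rfl⟩
      · simp [hx]
      · have h1 := hk.dist_le_mul (T t (S y)) y
        rw [Real.dist_eq, dist_eq_norm] at h1
        rw [hT0 y hy, ← sub_mul, ← mul_assoc, norm_mul, norm_mul, norm_inv, Real.norm_eq_abs t,
          Real.norm_eq_abs (k _ - _)]
        refine mul_le_mul_of_nonneg_right ?_ (norm_nonneg _)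
        rw [inv_mul_le_iff₀ ht0]
        calc |k (T t (S y)) - k y| ≤ L * ‖T t (S y) - y‖ := h1
          _ ≤ L * (2 * L / lam * |t|) := mul_le_mul_of_nonneg_left (hdist y hy t) L.2
          _ = _ := by ring
    · filter_upwards [hwS, hnull] with x hx hdx
      rcases hx with hx | ⟨y, hy, rfl⟩
      · simp [hV, hx]
      · have h1 := (hderiv y hy (hdx y hy rfl)).mul_const (w (S y))
        rw [hasDerivAt_iff_tendsto_slope_zero] at h1
        simpa [hV, hT0 y hy] using h1
  have hval : ∫ x in Ω, V x ∂ν =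
      -∫ y in Ω, |(A y).det| * (inner ℝ (gradient k y) (B y (gradient k y)) * w (S y)) ∂ν := by
    have h1 : ∫ x in Ω, V x ∂ν = ∫ x in S '' Ω, V x ∂ν := by
      refine setIntegral_eq_of_subset_of_ae_sdiff_eq_zero hΩo.nullMeasurableSet hmap.image_subset ?_
      filter_upwards [(ae_restrict_iff' hΩo.measurableSet).1 hwS] with x hx hxd
      rcases hx hxd.1 with h | h
      · simp [hV, h]
      · exact absurd h hxd.2
    rw [h1, integral_image_eq_integral_abs_det_fderiv_smul ν hΩo.measurableSet
      (fun y hy => (hS y hy).hasFDerivWithinAt) hinj, ← integral_neg]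
    refine setIntegral_congr_fun hΩo.measurableSet fun y hy => ?_
    simp [hV, hT0 y hy]
  rw [hasDerivAt_iff_tendsto_slope_zero, ← hval]
  refine hlim.congr fun t => ?_
  rw [integral_const_mul, integral_sub (hint t) (hint 0), zero_add, smul_eq_mul]

end ChangeOfVariables

/-! ### The first and second variations of `F`. -/

section SecondVariation

variable {d : ℕ} {Ω : Set (EuclideanSpace ℝ (Fin d))} {τ : ℝ}
  {μ φ h f k : EuclideanSpace ℝ (Fin d) → ℝ}

/-- The first variation of `F` along `h`, in terms of minimizers over the closure of `Ω`. -/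
theorem hasDerivAt_cTransformFunctional (hτ : 0 < τ) (hne : Ω.Nonempty) (hΩo : IsOpen Ω)
    (hΩb : Bornology.IsBounded Ω) (hμ : IntegrableOn μ Ω) (hf : Continuous f) (hk : Continuous k)
    (hfφ : Set.EqOn φ f Ω) (hkh : Set.EqOn h k Ω)
    {T : ℝ → EuclideanSpace ℝ (Fin d) → EuclideanSpace ℝ (Fin d)}
    (hT : ∀ t, IsArgminSelection (closure Ω)
      (fun y => ‖y‖ ^ 2 / 2 + τ * f y + t * (τ * k y)) (T t)) (t : ℝ) :
    IntegrableOn (fun x => τ * k (T t x) * μ x) Ω ∧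
      HasDerivAt (fun s : ℝ => cTransformFunctional Ω τ μ (φ + s • h))
        (τ⁻¹ * ∫ x in Ω, τ * k (T t x) * μ x) t := by
  have hK := hΩb.isCompact_closure
  obtain ⟨R, hR0, hR⟩ := hΩb.closure.exists_pos_norm_le
  lift R to NNReal using hR0.le
  have hbdd : ∀ g : EuclideanSpace ℝ (Fin d) → ℝ, Continuous g →
      IntegrableOn (fun x => g x * μ x) Ω := by
    intro g hg
    obtain ⟨C, hC⟩ := hK.exists_bound_of_continuousOn hg.continuousOn
    refine hμ.bdd_mul (c := C) hg.aestronglyMeasurable ?_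
    refine ae_restrict_of_forall_mem hΩo.measurableSet fun x hx => hC x (subset_closure hx)
  have hG : ∀ s, Continuous (minValue (fun y => ‖y‖ ^ 2 / 2 + τ * f y + s * (τ * k y)) (T s)) :=
    fun s => ((hT s).lipschitzWith hR).continuous
  have hF : ∀ s : ℝ, cTransformFunctional Ω τ μ (φ + s • h) =
      (∫ x in Ω, ‖x‖ ^ 2 / (2 * τ) * μ x) + τ⁻¹ * ∫ x in Ω,
        minValue (fun y => ‖y‖ ^ 2 / 2 + τ * f y + s * (τ * k y)) (T s) x * μ x := by
    intro s
    rw [← integral_const_mul, ← integral_add (hbdd _ (by fun_prop)) ((hbdd _ (hG s)).const_mul _)]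
    refine integral_congr_ae (Eventually.of_forall fun x => ?_)
    simp only
    rw [backwardCTransform_eq_minValue (f := fun y => f y + s * k y) hτ hne (by fun_prop)
      (fun y hy => by simp [hfφ hy, hkh hy]) (fun y => by ring) (hT s)]
    ring
  have hmain := hasDerivAt_integral_minValue (ν := volume) hK hμ
    (f := fun y => ‖y‖ ^ 2 / 2 + τ * f y) (k := fun y => τ * k y) (by fun_prop) (by fun_prop) hT
    (fun s => hbdd _ (hG s)) t
  refine ⟨hmain.1, ?_⟩
  simp only [hF]
  exact (hmain.2.const_mul _).const_add _

theorem gradient_const_mul (c : ℝ) (y : EuclideanSpace ℝ (Fin d)) :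
    gradient (fun z => c * k z) y = c • gradient k y := by
  have h1 : fderiv ℝ (fun z => c * k z) = c • fderiv ℝ k := fderiv_const_smul_field (f := k) c
  simp [gradient, h1]

theorem gradient_congr {y : EuclideanSpace ℝ (Fin d)} (h1 : h =ᶠ[𝓝 y] k) :
    gradient h y = gradient k y := by
  rw [gradient, gradient, h1.fderiv_eq]

theorem norm_gradient_le {K : NNReal} (hΩo : IsOpen Ω) (hh : LipschitzOnWith K h Ω)
    {y : EuclideanSpace ℝ (Fin d)} (hy : y ∈ Ω) : ‖gradient h y‖ ≤ K := by
  rw [gradient, LinearIsometryEquiv.norm_map]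
  exact norm_fderiv_le_of_lipschitzOn ℝ (hΩo.mem_nhds hy) hh

theorem measurable_gradient : Measurable (gradient h) :=
  (InnerProductSpace.toDual ℝ (EuclideanSpace ℝ (Fin d))).symm.continuous.measurable.comp
    (measurable_fderiv ℝ h)

theorem measurable_mapJacobian_apply (i j : Fin d) :
    Measurable fun y => mapJacobian τ φ y i j := by
  have h1 : Measurable (fderiv ℝ (fderiv ℝ φ)) := measurable_fderiv ℝ _
  have h2 : Measurable fun y => fderiv ℝ (fderiv ℝ φ) y (EuclideanSpace.single i 1) :=
    (ContinuousLinearMap.apply ℝ _ (EuclideanSpace.single i (1 : ℝ))).continuous.measurable.comp h1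
  have h3 : Measurable fun y =>
      fderiv ℝ (fderiv ℝ φ) y (EuclideanSpace.single i 1) (EuclideanSpace.single j 1) :=
    (ContinuousLinearMap.apply ℝ ℝ (EuclideanSpace.single j (1 : ℝ))).continuous.measurable.comp h2
  exact (h3.const_mul τ).const_add ((1 : Matrix (Fin d) (Fin d) ℝ) i j)

theorem measurable_comp_mapJacobian {g : Matrix (Fin d) (Fin d) ℝ → ℝ} (hg : Continuous g) :
    Measurable fun y => g (mapJacobian τ φ y) := by
  have h0 : Continuous (fun N : Fin d → Fin d → ℝ => g (Matrix.of N)) := hg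
  have h1 := h0.measurable
  exact h1.comp (measurable_pi_lambda _ fun i => measurable_pi_lambda _ fun j =>
    measurable_mapJacobian_apply i j)

theorem measurable_inner_adjugate :
    Measurable fun y => inner ℝ (gradient h y)
      (Matrix.toEuclideanLin (cofactorMatrix (mapJacobian τ φ y)) (gradient h y)) := by
  have hv : ∀ i, Measurable fun y => gradient h y i := fun i =>
    (EuclideanSpace.proj i : EuclideanSpace ℝ (Fin d) →L[ℝ] ℝ).continuous.measurable.comp
      measurable_gradient
  have hN : ∀ i j, Measurable fun y => cofactorMatrix (mapJacobian τ φ y) i j := fun i j =>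
    measurable_comp_mapJacobian (g := fun N => cofactorMatrix N i j)
      ((continuous_id.matrix_adjugate).matrix_elem j i)
  simp only [PiLp.inner_apply, Matrix.ofLp_toLpLin, Matrix.toLin'_apply, Matrix.mulVec, dotProduct]
  refine Finset.measurable_sum _ fun i _ => ?_
  exact (Finset.measurable_sum _ fun j _ => (hN i j).mul (hv j)).mul (hv i)

end SecondVariation

theorem hasSecondVariation_of_eq_zero {X : Type*} {F : (X → ℝ) → ℝ} (hF : ∀ φ, F φ = 0)
    (φ h : X → ℝ) : HasSecondVariation F φ h 0 := by
  refine ⟨fun _ => 0, Eventually.of_forall fun t => ?_, hasDerivAt_const 0 0⟩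
  simpa only [hF] using hasDerivAt_const t (0 : ℝ)

theorem lemma3 {d : ℕ} (hd : 1 ≤ d)
    (Ω : Set (EuclideanSpace ℝ (Fin d)))
    (hΩo : IsOpen Ω) (hΩb : Bornology.IsBounded Ω) (hΩc : Convex ℝ Ω)
    (τ : ℝ) (hτ : 0 < τ)
    (μ : EuclideanSpace ℝ (Fin d) → ℝ)
    (hμi : IntegrableOn μ Ω) (hμ0 : ∀ᵐ x ∂(volume.restrict Ω), 0 ≤ μ x)
    (φ : EuclideanSpace ℝ (Fin d) → ℝ)
    (hφc : IsCConvex Ω τ φ) (hφ2 : ContDiffOn ℝ 2 φ Ω)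
    -- uniform nondegeneracy of `I + τ D²φ`
    (lam : ℝ) (hlam : 0 < lam)
    (hlow : ∀ y ∈ Ω, ∀ κ : ℝ,
      Module.End.HasEigenvalue (Matrix.toLin' (mapJacobian τ φ y)) κ → lam ≤ κ)
    -- `T_φ` is well defined, with values in `Ω`, almost everywhere where `μ > 0`
    (hT : ∀ᵐ x ∂(volume.restrict Ω), 0 < μ x → ∃ y, IsCMinimizer Ω τ φ x y)
    (h : EuclideanSpace ℝ (Fin d) → ℝ) (hh : ∃ K : NNReal, LipschitzOnWith K h Ω) :
    ∃ δ2F : ℝ,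
      HasSecondVariation (cTransformFunctional Ω τ μ) φ h δ2F ∧
      IntegrableOn (hessianIntegrand τ μ φ h) Ω ∧
      δ2F = -τ * (∫ y in Ω, hessianIntegrand τ μ φ h y) ∧
      ∀ Λ : ℝ,
        (∀ y ∈ Ω, ∀ κ : ℝ,
          Module.End.HasEigenvalue (Matrix.toLin' (mapJacobian τ φ y)) κ → κ ≤ Λ) →
        MemLp μ ⊤ (volume.restrict Ω) →
        -δ2F ≤ τ * (eLpNorm μ ⊤ (volume.restrict Ω)).toReal * Λ ^ (d - 1) *
          (∫ y in Ω, ‖gradient h y‖ ^ 2) := by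
  rcases Ω.eq_empty_or_nonempty with rfl | hne
  · refine ⟨0, hasSecondVariation_of_eq_zero (fun φ => ?_) φ h, by simp, by simp, by simp⟩
    simp [cTransformFunctional]
  obtain ⟨Kφ, hKφ⟩ := hφc.exists_lipschitzOnWith hτ hΩb
  -- Extensions are needed because minimizers of the perturbed problems can lie on the boundary of
  -- `Ω`.
  obtain ⟨f, hfL, hfφ⟩ := hKφ.extend_real
  obtain ⟨Kh, hKh⟩ := hh
  obtain ⟨k, hkL, hkh⟩ := hKh.extend_real
  have hf := hfL.continuous
  have hk := hkL.continuous
  have hkτ : LipschitzWith (‖τ‖₊ * Kh) (fun y => τ * k y) := (lipschitzWith_smul τ).comp hkL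
  choose T hmin using fun t : ℝ => exists_isArgminSelection hΩb.isCompact_closure hne.closure
    (f := fun y => ‖y‖ ^ 2 / 2 + τ * f y + t * (τ * k y)) (by fun_prop)
  have hT0 : IsArgminSelection (closure Ω) (fun y => ‖y‖ ^ 2 / 2 + τ * f y) (T 0) := by
    simpa using hmin 0
  set S : EuclideanSpace ℝ (Fin d) → EuclideanSpace ℝ (Fin d) :=
    fun y => y + τ • gradient φ y with hS_def
  set A : EuclideanSpace ℝ (Fin d) → EuclideanSpace ℝ (Fin d) →L[ℝ] EuclideanSpace ℝ (Fin d) :=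
    fun y => Matrix.toEuclideanCLM (𝕜 := ℝ) (mapJacobian τ φ y) with hA_def
  set Φ : EuclideanSpace ℝ (Fin d) → ℝ := fun y => ‖y‖ ^ 2 / 2 + τ * f y with hΦ_def
  have hC2 : ∀ y ∈ Ω, ContDiffAt ℝ 2 φ y := fun y hy => hφ2.contDiffAt (hΩo.mem_nhds hy)
  have hherm : ∀ y ∈ Ω, (mapJacobian τ φ y).IsHermitian := fun y hy =>
    mapJacobian_isHermitian τ (hC2 y hy)
  have hdet : ∀ y ∈ Ω, 0 < (mapJacobian τ φ y).det := fun y hy =>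
    (hherm y hy).det_pos_of_eigenvalue_ge hlam (hlow y hy)
  have hΦ : ∀ y ∈ Ω, HasGradientAt Φ (S y) y := fun y hy =>
    hasGradientAt_sq_norm_add τ ((hC2 y hy).differentiableAt (by norm_num))
      (hfφ.symm.eventuallyEq_of_mem (hΩo.mem_nhds hy))
  have hS : ∀ y ∈ Ω, HasStrictFDerivAt S (A y) y := fun y hy =>
    hasStrictFDerivAt_id_add_gradient τ (hC2 y hy)
  have hA : ∀ y ∈ Ω, ∀ v, lam * ‖v‖ ^ 2 ≤ inner ℝ v (A y v) := fun y hy v =>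
    (hherm y hy).le_inner_toEuclideanLin (hlow y hy) v
  have hsymm : ∀ y ∈ Ω, ∀ u v, inner ℝ u (A y v) = inner ℝ v (A y u) := fun y hy u v => by
    rw [real_inner_comm]
    exact (Matrix.isSymmetric_toEuclideanLin_iff.2 (hherm y hy)) v u
  have hB : ∀ y ∈ Ω, ∀ v, A y (Matrix.toEuclideanLin (mapJacobian τ φ y)⁻¹ v) = v :=
    fun y hy v => Matrix.toEuclideanLin_inv_apply (hdet y hy).ne' v
  have hAdet : ∀ y, (A y).det = (mapJacobian τ φ y).det := fun y => Matrix.det_toEuclideanCLM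
  have hmapcl : Set.MapsTo S Ω (closure Ω) := fun y hy =>
    hφc.gradient_mem_closure hτ hΩo hΩb hf hfφ (fun _ => rfl) hT0 hy (hΦ y hy)
  have hmap : Set.MapsTo S Ω Ω := fun y hy =>
    mem_of_mapsTo_closure hΩo hΩc hmapcl hy (hS y hy) fun v => ⟨_, hB y hy v⟩
  have hS' : ∀ y ∈ Ω, HasFDerivAt S (A y) y := fun y hy => (hS y hy).hasFDerivAt
  have hinj : Set.InjOn S Ω := injOn_of_strongly_monotone hΩc hlam hΦ hS' hA
  -- A minimizer in the open set `Ω` is a critical point of `Φ - ⟪x, ·⟫`, so `x = S y`.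
  have hμS : ∀ᵐ x ∂(volume.restrict Ω), μ x = 0 ∨ x ∈ S '' Ω := by
    filter_upwards [hμ0, hT] with x hx0 hxT
    rcases hx0.eq_or_lt with h0 | hpos
    · exact Or.inl h0.symm
    obtain ⟨y, hy, hymin⟩ := hxT hpos
    refine Or.inr ⟨y, hy, IsLocalMin.gradient_eq ?_ (hΦ y hy)⟩
    filter_upwards [hΩo.mem_nhds hy] with z hz
    have h1 : φ y + ‖x - y‖ ^ 2 / (2 * τ) ≤ φ z + ‖x - z‖ ^ 2 / (2 * τ) := hymin hz
    rw [hfφ hy, hfφ hz, add_cost_eq hτ, add_cost_eq hτ, add_le_add_iff_left,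
      div_le_div_iff_of_pos_right hτ] at h1
    exact h1
  have hfirst := fun t => hasDerivAt_cTransformFunctional (φ := φ) (h := h) hτ hne hΩo hΩb hμi hf hk
    hfφ hkh hmin t
  have hgrad : ∀ y ∈ Ω, gradient (fun z => τ * k z) y = τ • gradient h y := fun y hy => by
    rw [gradient_const_mul, gradient_congr (hkh.eventuallyEq_of_mem (hΩo.mem_nhds hy))]
  have hcof : ∀ y ∈ Ω, cofactorMatrix (mapJacobian τ φ y) = (mapJacobian τ φ y).adjugate :=
    fun y hy => by
      have h1 : (mapJacobian τ φ y).transpose = mapJacobian τ φ y := by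
        simpa [Matrix.IsHermitian] using hherm y hy
      rw [cofactorMatrix, Matrix.adjugate_transpose, h1]
  have hintegrand : ∀ y ∈ Ω, hessianIntegrand τ μ φ h y = |(A y).det| *
      (inner ℝ (gradient h y) (Matrix.toEuclideanLin (mapJacobian τ φ y)⁻¹ (gradient h y)) *
        μ (S y)) := fun y hy => by
    rw [hessianIntegrand, hcof y hy, Matrix.toEuclideanLin_adjugate_eq (hdet y hy).ne',
      inner_smul_right, hAdet, abs_of_pos (hdet y hy), mul_assoc]
  have hnormgrad : ∀ y ∈ Ω, ‖gradient h y‖ ≤ Kh := fun y hy => norm_gradient_le hΩo hKh hy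
  -- No upper bound on the cofactor matrix is available. Its determinant factor is absorbed by the
  -- change of variables for `μ`, and the remaining `⟪∇h, A⁻¹∇h⟫` is at most `Kh² / lam`.
  have hint : IntegrableOn (hessianIntegrand τ μ φ h) Ω := by
    have h1 : IntegrableOn (fun y => |(A y).det| • μ (S y)) Ω :=
      (integrableOn_image_iff_integrableOn_abs_det_fderiv_smul volume hΩo.measurableSet
        (fun y hy => (hS' y hy).hasFDerivWithinAt) hinj μ).1 (hμi.mono_set hmap.image_subset)
    have h2 : Measurable fun y => inner ℝ (gradient h y)
        (Matrix.toEuclideanLin (cofactorMatrix (mapJacobian τ φ y)) (gradient h y)) /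
          (mapJacobian τ φ y).det :=
      measurable_inner_adjugate.div (measurable_comp_mapJacobian continuous_id.matrix_det)
    have h3 : ∀ y ∈ Ω, inner ℝ (gradient h y)
        (Matrix.toEuclideanLin (cofactorMatrix (mapJacobian τ φ y)) (gradient h y)) /
          (mapJacobian τ φ y).det = inner ℝ (gradient h y)
            (Matrix.toEuclideanLin (mapJacobian τ φ y)⁻¹ (gradient h y)) := fun y hy => by
      rw [hcof y hy, Matrix.toEuclideanLin_adjugate_eq (hdet y hy).ne', inner_smul_right,
        mul_div_cancel_left₀ _ (hdet y hy).ne']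
    refine (Integrable.bdd_mul (c := Kh * (Kh / lam)) h1 h2.aestronglyMeasurable ?_).congr ?_
    · refine ae_restrict_of_forall_mem hΩo.measurableSet fun y hy => ?_
      rw [h3 y hy]
      set v := gradient h y
      set b := Matrix.toEuclideanLin (mapJacobian τ φ y)⁻¹ v
      have h4 : lam * ‖b‖ ^ 2 ≤ ‖b‖ * ‖v‖ := by
        have h5 := hA y hy b
        rw [hB y hy v] at h5
        exact h5.trans (real_inner_le_norm _ _)
      have h5 : ‖b‖ ≤ ‖v‖ / lam := by
        rw [le_div_iff₀ hlam]
        rcases (norm_nonneg b).eq_or_lt with h0 | h0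
        · rw [← h0, zero_mul]
          exact norm_nonneg v
        · refine le_of_mul_le_mul_left ?_ h0
          linarith [h4, sq ‖b‖, mul_comm lam (‖b‖ ^ 2), mul_assoc ‖b‖ ‖b‖ lam,
            congrArg (· * lam) (sq ‖b‖)]
      calc ‖inner ℝ v b‖ ≤ ‖v‖ * ‖b‖ := norm_inner_le_norm _ _
        _ ≤ Kh * (Kh / lam) := by
          have h6 := hnormgrad y hy
          have h7 : ‖b‖ ≤ Kh / lam := h5.trans (by gcongr)
          gcongr
    · refine ae_restrict_of_forall_mem hΩo.measurableSet fun y hy => ?_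
      simp only
      rw [h3 y hy, hintegrand y hy, smul_eq_mul]
      ring
  refine ⟨-τ * ∫ y in Ω, hessianIntegrand τ μ φ h y,
    ⟨fun t => τ⁻¹ * ∫ x in Ω, τ * k (T t x) * μ x,
      Eventually.of_forall fun t => (hfirst t).2, ?_⟩, hint, rfl, ?_⟩
  · have hsecond := (hasDerivAt_integral_comp_argmin (ν := volume) hΩo hΩc hlam hΦ hS' hA
      (by fun_prop) hsymm hB hmap hkτ hμi hμS hmin (fun t => (hfirst t).1)).const_mul τ⁻¹
    refine hsecond.congr_deriv ?_
    -- The two gradients of `τ * k` give `τ ^ 2`, which the prefactor `τ⁻¹` reduces to `τ`.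
    have h1 : ∫ y in Ω, |(A y).det| * (inner ℝ (gradient (fun z => τ * k z) y)
        (Matrix.toEuclideanLin (mapJacobian τ φ y)⁻¹ (gradient (fun z => τ * k z) y)) *
          μ (S y)) = ∫ y in Ω, τ ^ 2 * hessianIntegrand τ μ φ h y := by
      refine setIntegral_congr_fun hΩo.measurableSet fun y hy => ?_
      rw [hgrad y hy, hintegrand y hy, map_smul, inner_smul_left, inner_smul_right]
      simp only [conj_trivial]
      ring
    rw [h1, integral_const_mul]
    field_simp
  · intro Λ hup hμb
    obtain ⟨y₀, hy₀⟩ := hne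
    set N := (eLpNorm μ ⊤ (volume.restrict Ω)).toReal with hN
    have hμN : ∀ᵐ x ∂(volume.restrict Ω), 0 ≤ μ x ∧ μ x ≤ N := by
      filter_upwards [hμ0, ae_le_eLpNormEssSup (f := μ) (μ := volume.restrict Ω)] with x h0 h1
      refine ⟨h0, (le_abs_self _).trans ?_⟩
      rw [← eLpNorm_exponent_top] at h1
      have h2 := ENNReal.toReal_mono hμb.eLpNorm_ne_top h1
      rw [hN, eLpNorm_exponent_top]
      simpa using h2
    have hμSN := ae_restrict_comp_of_det_ne_zero hΩo.measurableSet hS' hinj hmap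
      (fun y hy => by rw [hAdet]; exact (hdet y hy).ne') hμN
    have hint2 : IntegrableOn (fun y => N * Λ ^ (d - 1) * ‖gradient h y‖ ^ 2) Ω := by
      refine Integrable.const_mul ?_ _
      refine IntegrableOn.of_bound hΩb.measure_lt_top
        (measurable_gradient.norm.pow_const 2).aestronglyMeasurable ((Kh : ℝ) ^ 2) ?_
      refine ae_restrict_of_forall_mem hΩo.measurableSet fun y hy => ?_
      rw [norm_pow, norm_norm]
      exact pow_le_pow_left₀ (norm_nonneg _) (hnormgrad y hy) 2
    have hle : ∫ y in Ω, hessianIntegrand τ μ φ h y ≤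
        ∫ y in Ω, N * Λ ^ (d - 1) * ‖gradient h y‖ ^ 2 := by
      refine setIntegral_mono_ae_restrict hint hint2 ?_
      filter_upwards [hμSN, ae_restrict_mem hΩo.measurableSet] with y hyμ hy
      have h1 := (hherm y hy).inner_adjugate_le hlam (hlow y hy) (hup y hy) (gradient h y)
      have h2 : 0 ≤ Λ ^ (d - 1) * ‖gradient h y‖ ^ 2 := by
        -- Here `d ≥ 1` enters: some eigenvalue must exist to lie between `lam` and `Λ`.
        have h3 : (0 : ℝ) ≤ Λ := by
          have i : Fin d := ⟨0, hd⟩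
          have h4 := (hherm y hy).hasEigenvalue_eigenvalues i
          exact (hlam.le.trans (hlow y hy _ h4)).trans (hup y hy _ h4)
        positivity
      rw [hessianIntegrand, hcof y hy]
      calc _ ≤ Λ ^ (d - 1) * ‖gradient h y‖ ^ 2 * μ (S y) :=
            mul_le_mul_of_nonneg_right h1 hyμ.1
        _ ≤ Λ ^ (d - 1) * ‖gradient h y‖ ^ 2 * N := mul_le_mul_of_nonneg_left hyμ.2 h2
        _ = _ := by ring
    rw [integral_const_mul] at hle
    have := mul_le_mul_of_nonneg_left hle hτ.le
    linarith
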